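/- For $d\ge 3$ let $d$-SAT be the problem of deciding the satisfiability of a CNF formula whose clauses have at most $d$ literals each, and let $c_d$ be the infimum of all real $c$ such that $d$-SAT on formulas $\varphi$ with $n$ variables is solvable by a deterministic algorithm in time $2^{cn}\cdot|\varphi|^{O(1)}$. The strong exponential-time hypothesis (SETH) states that $\lim_{d\to\infty}c_d=1$. A $\forall\exists 3$-CNF is a quantified Boolean formula $\forall x_1\cdots\forall x_\ell\,\exists y_1\cdots\exists y_k.\,\varphi$ with $\ell\ge 1$ and $k\ge 0$, where $\varphi$ is a CNF formula over the variables $x_1,\dots,x_\ell,y_1,\dots,y_k$ with at most three literals in every clause. In all CNF formulas, clauses are sets of literals, no clause contains a literal together with its negation, and no clause is repeated. The size $|\varphi|$ of a formula is the number of its (declared or quantified) variables plus the number of its clauses plus the number of its literal occurrences. Algorithms are deterministic $\mathtt{while}$ programs on binary trees, in which testing, following or creating one tree node has unit cost; formulas are presented as trees that list the variables (or quantifiers) and the clauses, with the indices of variables in unary, so that the length of the input is polynomial in $|\varphi|$. Theorem. Assume SETH. Then for no constant $c\in\mathbb{R}$ is there a deterministic algorithm that decides whether a given $\forall\exists 3$-CNF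 is true and whose running time on formulas with matrix $\varphi$ and $k$ existential variables is at most $c^k\cdot|\varphi|^{O(1)}$. -/

import Mathlib

namespace QBFLower

/-! ### Boolean formulas in conjunctive normal form -/

/-- A literal: the variable `x_i` is `(i, true)` and its negation is `(i, false)`. -/
abbrev Literal := ℕ × Bool

/-- A clause, given by a list of its literals. -/
abbrev Clause := List Literal

/-- A literal is true under the assignment `a`. -/
def Literal.Holds (a : ℕ → Bool) (l : Literal) : Prop := a l.1 = l.2

/-- The conjunction of the clauses is true under `a`. -/
def MatrixHolds (a : ℕ → Bool) (cs : List Clause) : Prop :=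
  ∀ C ∈ cs, ∃ l ∈ C, Literal.Holds a l

/-- The clauses are written over the variables `x_0, …, x_{n-1}`, no clause contains a literal
twice or a literal together with its negation, and no clause (as a set of literals) is
repeated. -/
def ProperMatrix (n : ℕ) (cs : List Clause) : Prop :=
  (∀ C ∈ cs, C.Nodup ∧ (∀ l ∈ C, l.1 < n) ∧ ∀ i : ℕ, ¬ ((i, true) ∈ C ∧ (i, false) ∈ C)) ∧
    cs.Pairwise (fun C D => ¬ ∀ l : Literal, l ∈ C ↔ l ∈ D)

/-- Every clause has at most `d` literals. -/
def WidthAtMost (d : ℕ) (cs : List Clause) : Prop := ∀ C ∈ cs, C.length ≤ d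

/-- Each clause contributes its number of literals plus one. -/
def matrixSize (cs : List Clause) : ℕ := (cs.map fun C => C.length + 1).sum

/-- A propositional CNF formula with variables `x_0, …, x_{numVars-1}`. -/
structure CNF where
  numVars : ℕ
  clauses : List Clause

/-- The instances of `d`-SAT: formulas in `d`-CNF. -/
def CNF.IsInstance (d : ℕ) (φ : CNF) : Prop :=
  ProperMatrix φ.numVars φ.clauses ∧ WidthAtMost d φ.clauses

def CNF.Satisfiable (φ : CNF) : Prop := ∃ a : ℕ → Bool, MatrixHolds a φ.clauses

/-- The size of a CNF formula. -/
def CNF.size (φ : CNF) : ℕ := φ.numVars + matrixSize φ.clauses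

/-! ### Quantified Boolean formulas -/

inductive Quant where
  | all
  | ex
  deriving DecidableEq

/-- A quantified CNF formula `Q_0 x_0 … Q_{n-1} x_{n-1}. φ`; here `quants` is the list
`Q_0, …, Q_{n-1}` and `matrix` is `φ`. -/
structure QCNF where
  quants : List Quant
  matrix : List Clause

/-- The truth value of a quantified formula, by recursion on its quantifiers. In
`TrueFrom i Q cs a` the variables before `x_i` have already been given values (recorded in `a`)
and `Q` quantifies `x_i, x_{i+1}, …`. -/
def TrueFrom : ℕ → List Quant → List Clause → (ℕ → Bool) → Prop
  | _, [], cs, a => MatrixHolds a cs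
  | i, Quant.ex :: Q, cs, a =>
      TrueFrom (i + 1) Q cs (Function.update a i false) ∨
        TrueFrom (i + 1) Q cs (Function.update a i true)
  | i, Quant.all :: Q, cs, a =>
      TrueFrom (i + 1) Q cs (Function.update a i false) ∧
        TrueFrom (i + 1) Q cs (Function.update a i true)

/-- The formula is true. The initial assignment is irrelevant for formulas all of whose variables
are quantified. -/
def QCNF.IsTrue (Φ : QCNF) : Prop := TrueFrom 0 Φ.quants Φ.matrix (fun _ => false)

/-- The number of existential variables. -/
def QCNF.numEx (Φ : QCNF) : ℕ := Φ.quants.count Quant.ex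

/-- The quantifiers are a non-empty block of universal ones followed by a (possibly empty) block
of existential ones. -/
def QCNF.IsForallExists (Φ : QCNF) : Prop :=
  ∃ l k : ℕ, 1 ≤ l ∧ Φ.quants = List.replicate l Quant.all ++ List.replicate k Quant.ex

/-- The formula is a `∀∃d-CNF`. -/
def QCNF.IsForallExistsCNF (d : ℕ) (Φ : QCNF) : Prop :=
  Φ.IsForallExists ∧ ProperMatrix Φ.quants.length Φ.matrix ∧ WidthAtMost d Φ.matrix

/-- The size of a quantified CNF formula. -/
def QCNF.size (Φ : QCNF) : ℕ := Φ.quants.length + matrixSize Φ.matrix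

/-! ### The model of computation

Deterministic `while` programs on binary trees with unit costs. A tree is a pointer to a cell, and
every primitive operation creates, follows or tests one pointer, so each unit of cost is a constant
number of steps of a pointer machine or of a random access machine. Conversely, a random access
machine that runs for `T` steps on words of `O(log T)` bits is simulated in
`T * (log T) ^ O(1)` steps by keeping its memory in a balanced tree. Running times of the form
`2 ^ O(n)` are therefore the same in both models up to factors polynomial in `n`. -/

/-- The data: binary trees. -/
inductive BTree where
  | nil
  | node (l r : BTree)

def BTree.left : BTree → BTree
  | nil => nil
  | node l _ => l

def BTree.right : BTree → BTree
  | nil => nil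
  | node _ r => r

/-- Programs with one tree-valued variable `x`; a program also has a value, which `comp` (sequential
composition) and `loop` write back to `x`. The value of
* `skip` is `x`, and that of `nil` is the empty tree;
* `left`, `right` is the left or right subtree of `x`;
* `pair f g` is the tree whose subtrees are the values of `f` and `g` on `x`;
* `comp f g` is the value of `g` on the value of `f` on `x`;
* `cond b f g` is that of `f` on `x` if the value of `b` on `x` is a non-empty tree, and that of
  `g` on `x` otherwise;
* `loop b f` is the final `x` of `while b(x) is non-empty do x := f(x)`. -/
inductive Prog where
  | skip
  | nil
  | left
  | right
  | pair (f g : Prog)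
  | comp (f g : Prog)
  | cond (b f g : Prog)
  | loop (b f : Prog)

/-- `Runs p x y t`: on input `x` the program `p` halts with value `y` after exactly `t` steps. -/
inductive Runs : Prog → BTree → BTree → ℕ → Prop where
  | skip (x : BTree) : Runs Prog.skip x x 1
  | nil (x : BTree) : Runs Prog.nil x BTree.nil 1
  | left (x : BTree) : Runs Prog.left x x.left 1
  | right (x : BTree) : Runs Prog.right x x.right 1
  | pair {f g : Prog} {x y z : BTree} {s t : ℕ} :
      Runs f x y s → Runs g x z t → Runs (Prog.pair f g) x (BTree.node y z) (s + t + 1)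
  | comp {f g : Prog} {x y z : BTree} {s t : ℕ} :
      Runs f x y s → Runs g y z t → Runs (Prog.comp f g) x z (s + t + 1)
  | condTrue {b f g : Prog} {x u v y : BTree} {s t : ℕ} :
      Runs b x (BTree.node u v) s → Runs f x y t → Runs (Prog.cond b f g) x y (s + t + 1)
  | condFalse {b f g : Prog} {x y : BTree} {s t : ℕ} :
      Runs b x BTree.nil s → Runs g x y t → Runs (Prog.cond b f g) x y (s + t + 1)
  | loopDone {b f : Prog} {x : BTree} {s : ℕ} :
      Runs b x BTree.nil s → Runs (Prog.loop b f) x x (s + 1)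
  | loopStep {b f : Prog} {x u v y z : BTree} {s t r : ℕ} :
      Runs b x (BTree.node u v) s → Runs f x y t → Runs (Prog.loop b f) y z r →
        Runs (Prog.loop b f) x z (s + t + r + 1)

/-- The program `p` decides, on all instances in `S`, whether the instance has the property `yes`,
and its running time on an instance `i` in `S` is at most `bound i`. The instance is presented as
the tree `enc i`, and a non-empty value means acceptance. -/
def DecidesWithin {ι : Type} (p : Prog) (enc : ι → BTree) (S : ι → Prop) (yes : ι → Prop)
    (bound : ι → ℝ) : Prop :=
  ∀ i : ι, S i → ∃ (y : BTree) (t : ℕ),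
    Runs p (enc i) y t ∧ (t : ℝ) ≤ bound i ∧ (y ≠ BTree.nil ↔ yes i)

/-! ### Formulas as input data

Indices of variables are written in unary; as every index is smaller than the number of variables
of the formula, the length of this presentation is polynomial in the size of the formula. -/

def encList {α : Type} (f : α → BTree) : List α → BTree
  | [] => BTree.nil
  | a :: as => BTree.node (f a) (encList f as)

def encBool : Bool → BTree
  | false => BTree.nil
  | true => BTree.node BTree.nil BTree.nil

def encNat : ℕ → BTree
  | 0 => BTree.nil
  | n + 1 => BTree.node BTree.nil (encNat n)

def encLiteral (l : Literal) : BTree := BTree.node (encBool l.2) (encNat l.1)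

def encMatrix (cs : List Clause) : BTree := encList (encList encLiteral) cs

def encQuant : Quant → BTree
  | Quant.all => encBool false
  | Quant.ex => encBool true

def CNF.enc (φ : CNF) : BTree := BTree.node (encNat φ.numVars) (encMatrix φ.clauses)

def QCNF.enc (Φ : QCNF) : BTree := BTree.node (encList encQuant Φ.quants) (encMatrix Φ.matrix)

/-! ### The strong exponential-time hypothesis -/

/-- `d`-SAT is solvable in time `2 ^ (c * n)`, up to a factor polynomial in the size of the formula,
where `n` is the number of variables. -/
def SatSolvable (d : ℕ) (c : ℝ) : Prop :=
  ∃ (p : Prog) (q : Polynomial ℕ),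
    DecidesWithin p CNF.enc (CNF.IsInstance d) CNF.Satisfiable
      (fun φ => (2 : ℝ) ^ (c * (φ.numVars : ℝ)) * ((q.eval φ.size : ℕ) : ℝ))

/-- The infimum of all constants `c` such that `d`-SAT is solvable in time `2 ^ (c * n)`. -/
noncomputable def satExponent (d : ℕ) : ℝ := sInf {c : ℝ | SatSolvable d c}

/-- The strong exponential-time hypothesis: the exponents of `d`-SAT tend to `1`. -/
def SETH : Prop := Filter.Tendsto satExponent Filter.atTop (nhds 1)

/-- Deciding the truth of `∀∃d-CNF` formulas `Φ` with `k` existential variables is possible in time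
`c ^ k * |Φ| ^ O(1)`. -/
def ForallExistsSolvable (d : ℕ) (c : ℝ) : Prop :=
  ∃ (p : Prog) (q : Polynomial ℕ),
    DecidesWithin p QCNF.enc (QCNF.IsForallExistsCNF d) QCNF.IsTrue
      (fun Φ => c ^ Φ.numEx * ((q.eval Φ.size : ℕ) : ℝ))

end QBFLower

/-! Suppose `∀∃3-CNF` formulas could be decided in time `c ^ k` up to polynomial factors. Then
`d`-SAT would be solvable in time `2 ^ (n / 2)` for every `d` (`ForallExistsSolvable.satSolvable`),
so all the exponents would be at most `1 / 2` and could not tend to `1`.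

The first ingredient is a formula for unsatisfiability with few existential variables. Put the
clauses of a CNF formula into an array with `s` rows and `r` columns. The formula is unsatisfiable
iff for every assignment there are a row and a column that meet in a false clause. Naming a row and
a column takes `2 * s + 2 * r + 2` existential variables if auxiliary variables keep the clauses
short, and "the named clause is false" splits into one 3-clause for each of its literals
(`isTrue_falsityFormula`, `numEx_falsityFormula`). With linearly many clauses, `r` can be a large
constant and `s` a small fraction of `n`, so that `c ^ k` is at most a constant times `2 ^ (n / 4)`
(`exists_base_le_two_pow`).

The second ingredient makes the number of clauses linear: a deterministic sparsification. If some
nonempty set `H` of literals, the heart, lies in too many clauses of one length `w`, then branch: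
either `H` is satisfied, and is added as a clause, or all the petals `C \ H` are satisfied, and are
added instead. Supersets of added clauses are dropped. If no heart is heavy, the number of clauses
is linear in `n` (`length_le_of_branch_eq_nil`).

The search tree is small because of a potential that weighs an added clause of length `s` by `1 /
threshold K s`. Treating short clauses first, and large hearts before small ones, keeps the added
clauses spread out (`SparsifyInv`), so the potential never exceeds `d * n / K`. The heart branch
raises it slightly, the petal branch by more than `1`. Weighing the two branches against each other
bounds the number of nodes by `2 ^ (Λ * d * n / K)` up to a factor `2`
(`SparsifyInv.exists_searchTree`), and `Λ` is only logarithmic in `K`, so this can be brought down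
to `2 * 2 ^ (n / 4)`.

The rest shows that branching and the construction of the formula take polynomial time in the given
machine model, and that a depth-first search runs through the tree. -/

namespace QBFLower

open Polynomial

/-! ### Encoded types -/

/-- Number of cells of a tree, counting empty trees. -/
def BTree.size : BTree → ℕ
  | nil => 1
  | node l r => l.size + r.size + 1

theorem BTree.size_pos (t : BTree) : 1 ≤ t.size := by
  cases t <;> simp [BTree.size]

/-- Types whose elements are presented as trees. -/
class Enc (α : Type) where
  enc : α → BTree

open Enc

instance : Enc Unit := ⟨fun _ => BTree.nil⟩
instance : Enc Bool := ⟨encBool⟩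
instance : Enc ℕ := ⟨encNat⟩
instance : Enc Quant := ⟨encQuant⟩
instance instEncProd {α β : Type} [Enc α] [Enc β] : Enc (α × β) :=
  ⟨fun x => BTree.node (enc x.1) (enc x.2)⟩
instance instEncList {α : Type} [Enc α] : Enc (List α) := ⟨encList enc⟩
-- `Literal` unfolds to `ℕ × Bool`, for which the product instance would put the index first,
-- whereas `encLiteral` puts the sign first. The priority selects the prescribed presentation. This
-- is why literals have their own projections and pairing below.
instance (priority := high) instEncLiteral : Enc Literal := ⟨encLiteral⟩

/-- The size of the presentation of `a`. -/
def sz {α : Type} [Enc α] (a : α) : ℕ := (enc a).size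

section

variable {α β γ δ σ : Type} [Enc α] [Enc β] [Enc γ] [Enc δ] [Enc σ]

theorem sz_pos (a : α) : 1 ≤ sz a := BTree.size_pos _

@[simp] theorem sz_prod (x : α × β) : sz x = sz x.1 + sz x.2 + 1 := rfl
@[simp] theorem sz_literal (l : Literal) : sz l = sz l.2 + sz l.1 + 1 := rfl
@[simp] theorem sz_nil : sz ([] : List α) = 1 := rfl
@[simp] theorem sz_cons (a : α) (l : List α) : sz (a :: l) = sz a + sz l + 1 := rfl
@[simp] theorem sz_unit (u : Unit) : sz u = 1 := rfl

@[simp] theorem sz_nat (n : ℕ) : sz n = 2 * n + 1 := by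
  induction n with
  | zero => rfl
  | succ n ih =>
    have h : sz (n + 1) = 1 + sz n + 1 := rfl
    rw [h, ih]; ring

theorem sz_bool_le (b : Bool) : sz b ≤ 3 := by cases b <;> decide

theorem sz_append (l₁ l₂ : List α) : sz (l₁ ++ l₂) + 1 = sz l₁ + sz l₂ := by
  induction l₁ with
  | nil => simp; ring
  | cons a l ih => simp only [List.cons_append, sz_cons]; omega

theorem sz_reverse (l : List α) : sz l.reverse = sz l := by
  induction l with
  | nil => rfl
  | cons b l ih =>
    have := sz_append l.reverse [b]
    simp only [List.reverse_cons, sz_cons, sz_nil] at *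
    omega

theorem length_lt_sz (l : List α) : l.length < sz l := by
  induction l with
  | nil => simp
  | cons a l ih => simp only [List.length_cons, sz_cons]; omega

theorem sz_le_of_mem {a : α} {l : List α} (h : a ∈ l) : sz a ≤ sz l := by
  induction l with
  | nil => simp at h
  | cons b l ih =>
    rcases List.mem_cons.1 h with rfl | h
    · simp only [sz_cons]; omega
    · have := ih h
      simp only [sz_cons]; omega

theorem sz_list_le (l : List α) (M : ℕ) (h : ∀ a ∈ l, sz a ≤ M) :
    sz l ≤ l.length * (M + 1) + 1 := by
  induction l with
  | nil => simp
  | cons b l ih =>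
    have h1 := ih fun a ha => h a (List.mem_cons_of_mem _ ha)
    have h2 := h b List.mem_cons_self
    simp only [sz_cons, List.length_cons]
    nlinarith

theorem sz_prefix_le {l₁ l : List α} (h : l₁ <+: l) : sz l₁ ≤ sz l := by
  obtain ⟨l₂, rfl⟩ := h
  have := sz_append l₁ l₂
  have := sz_pos l₂
  omega

theorem eval_mono (q : ℕ[X]) {a b : ℕ} (h : a ≤ b) : q.eval a ≤ q.eval b := by
  simp only [eval_eq_sum, Polynomial.sum]
  exact Finset.sum_le_sum fun i _ => Nat.mul_le_mul_left _ (Nat.pow_le_pow_left h i)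

/-! ### Functions computable in polynomial time -/

/-- The program `p` computes `f`, and `q` bounds its running time and the size of its value. -/
def Computes (p : Prog) (q : ℕ[X]) (f : α → β) : Prop :=
  ∀ a, ∃ t, Runs p (enc a) (enc (f a)) t ∧ t ≤ q.eval (sz a) ∧ sz (f a) ≤ q.eval (sz a)

/-- The function is computable in polynomial time. -/
def Poly (f : α → β) : Prop := ∃ (p : Prog) (q : ℕ[X]), Computes p q f

theorem Poly.congr {f g : α → β} (hf : Poly f) (h : ∀ a, f a = g a) : Poly g := by
  rwa [show g = f from funext fun a => (h a).symm]

theorem Poly.of_enc_eq {f : α → β} (h : ∀ a, enc (f a) = enc a) : Poly f := by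
  refine ⟨Prog.skip, X, fun a => ⟨1, ?_, ?_, ?_⟩⟩
  · rw [h]; exact Runs.skip _
  · simpa using sz_pos a
  · simp [sz, h]

theorem exists_prog_const (y : BTree) : ∃ (p : Prog) (t : ℕ), ∀ x, Runs p x y t := by
  induction y with
  | nil => exact ⟨Prog.nil, 1, Runs.nil⟩
  | node l r hl hr =>
    obtain ⟨p, s, hp⟩ := hl
    obtain ⟨q, t, hq⟩ := hr
    exact ⟨Prog.pair p q, s + t + 1, fun x => Runs.pair (hp x) (hq x)⟩

theorem Poly.const (b : β) : Poly (fun _ : α => b) := by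
  obtain ⟨p, t, h⟩ := exists_prog_const (enc b)
  refine ⟨p, C (t + sz b), fun a => ⟨t, h _, ?_, ?_⟩⟩ <;> simp

theorem Poly.comp {g : β → γ} {f : α → β} (hg : Poly g) (hf : Poly f) :
    Poly (fun a => g (f a)) := by
  obtain ⟨p, q, hp⟩ := hf
  obtain ⟨p', q', hp'⟩ := hg
  refine ⟨Prog.comp p p', q + q'.comp q + 1, fun a => ?_⟩
  obtain ⟨t, h1, h2, h3⟩ := hp a
  obtain ⟨t', h1', h2', h3'⟩ := hp' (f a)
  have := eval_mono q' h3
  refine ⟨_, Runs.comp h1 h1', ?_, ?_⟩ <;> simp only [eval_add, eval_comp, eval_one] <;> omega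

theorem Poly.pair {f : α → β} {g : α → γ} (hf : Poly f) (hg : Poly g) :
    Poly (fun a => (f a, g a)) := by
  obtain ⟨p, q, hp⟩ := hf
  obtain ⟨p', q', hp'⟩ := hg
  refine ⟨Prog.pair p p', q + q' + 1, fun a => ?_⟩
  obtain ⟨t, h1, h2, h3⟩ := hp a
  obtain ⟨t', h1', h2', h3'⟩ := hp' a
  refine ⟨_, Runs.pair h1 h1', ?_, ?_⟩ <;>
    simp only [eval_add, eval_one, sz_prod] <;> omega

theorem Poly.fst : Poly (fun x : α × β => x.1) := by
  refine ⟨Prog.left, X + 1, fun a => ⟨1, Runs.left _, by simp, ?_⟩⟩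
  simp only [sz_prod, eval_add, eval_X, eval_one]
  omega

theorem Poly.snd : Poly (fun x : α × β => x.2) := by
  refine ⟨Prog.right, X + 1, fun a => ⟨1, Runs.right _, by simp, ?_⟩⟩
  simp only [sz_prod, eval_add, eval_X, eval_one]
  omega

theorem Poly.fst' {f : α → β × γ} (hf : Poly f) : Poly (fun a => (f a).1) := Poly.fst.comp hf

theorem Poly.snd' {f : α → β × γ} (hf : Poly f) : Poly (fun a => (f a).2) := Poly.snd.comp hf

theorem Poly.literal {f : α → ℕ} {g : α → Bool} (hf : Poly f) (hg : Poly g) :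
    Poly (fun a => ((f a, g a) : Literal)) := by
  obtain ⟨p, q, hp⟩ := hg.pair hf
  exact ⟨p, q, hp⟩

theorem Poly.literalVar {f : α → Literal} (hf : Poly f) : Poly (fun a => (f a).1) := by
  refine Poly.comp (g := fun l : Literal => l.1) ⟨Prog.right, X + 1, fun a => ?_⟩ hf
  refine ⟨1, Runs.right _, by simp, ?_⟩
  simp only [sz_literal, eval_add, eval_X, eval_one]
  omega

theorem Poly.literalSign {f : α → Literal} (hf : Poly f) : Poly (fun a => (f a).2) := by
  refine Poly.comp (g := fun l : Literal => l.2) ⟨Prog.left, X + 1, fun a => ?_⟩ hf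
  refine ⟨1, Runs.left _, by simp, ?_⟩
  simp only [sz_literal, eval_add, eval_X, eval_one]
  omega

theorem Poly.cond {b : α → Bool} {f g : α → β} (hb : Poly b) (hf : Poly f) (hg : Poly g) :
    Poly (fun a => bif b a then f a else g a) := by
  obtain ⟨p₀, q₀, h₀⟩ := hb
  obtain ⟨p₁, q₁, h₁⟩ := hf
  obtain ⟨p₂, q₂, h₂⟩ := hg
  refine ⟨Prog.cond p₀ p₁ p₂, q₀ + q₁ + q₂ + 1, fun a => ?_⟩
  obtain ⟨t₀, r₀, b₀, -⟩ := h₀ a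
  obtain ⟨t₁, r₁, b₁, c₁⟩ := h₁ a
  obtain ⟨t₂, r₂, b₂, c₂⟩ := h₂ a
  simp only [eval_add, eval_one]
  cases hb : b a
  · rw [hb] at r₀
    exact ⟨_, Runs.condFalse r₀ r₂, by omega, by simp only [cond_false]; omega⟩
  · rw [hb] at r₀
    exact ⟨_, Runs.condTrue r₀ r₁, by omega, by simp only [cond_true]; omega⟩

/-- A list is presented by the empty tree iff it is empty, so `cond` can test it directly. A
nonempty list has the same presentation as the pair of its head and its tail, so no program is
needed to take it apart. -/
theorem Poly.listCases {l : α → List β} {f : α → γ} {g : α × β × List β → γ} {h : α → γ}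
    (hl : Poly l) (hf : Poly f) (hg : Poly g) (h0 : ∀ a, l a = [] → h a = f a)
    (h1 : ∀ a b bs, l a = b :: bs → h a = g (a, b, bs)) : Poly h := by
  obtain ⟨p₀, q₀, h₀⟩ := hl
  obtain ⟨p₁, q₁, h₁⟩ := hf
  obtain ⟨p₂, q₂, h₂⟩ := hg
  refine ⟨Prog.cond p₀ (Prog.comp (Prog.pair Prog.skip p₀) p₂) p₁,
    q₀ + q₀ + q₁ + q₂.comp (X + q₀ + 1) + 5, fun a => ?_⟩
  obtain ⟨t₀, r₀, b₀, c₀⟩ := h₀ a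
  obtain ⟨t₁, r₁, b₁, c₁⟩ := h₁ a
  cases hla : l a with
  | nil =>
    rw [hla] at r₀
    rw [h0 a hla]
    refine ⟨_, Runs.condFalse r₀ r₁, ?_, ?_⟩ <;>
      simp only [eval_add, eval_one, eval_comp, eval_X, eval_ofNat] <;> omega
  | cons b bs =>
    obtain ⟨t₂, r₂, b₂, c₂⟩ := h₂ (a, b, bs)
    have hm : q₂.eval (sz (a, b, bs)) ≤ q₂.eval (sz a + q₀.eval (sz a) + 1) := by
      apply eval_mono
      rw [hla] at c₀
      simp only [sz_prod, sz_cons] at c₀ ⊢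
      omega
    rw [hla] at r₀
    rw [h1 a b bs hla]
    refine ⟨_, Runs.condTrue r₀ (Runs.comp (Runs.pair (Runs.skip _) r₀) r₂), ?_, ?_⟩ <;>
      simp only [eval_add, eval_one, eval_comp, eval_X, eval_ofNat] <;> omega

theorem Poly.nil : Poly (fun _ : α => ([] : List β)) := Poly.const _

theorem Poly.cons {f : α → β} {g : α → List β} (hf : Poly f) (hg : Poly g) :
    Poly (fun a => f a :: g a) := by
  obtain ⟨p, q, hp⟩ := hf.pair hg
  exact ⟨p, q, hp⟩

theorem Poly.exists_size_le {f : α → β} (hf : Poly f) :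
    ∃ q : ℕ[X], ∀ a, sz (f a) ≤ q.eval (sz a) := by
  obtain ⟨p, q, h⟩ := hf
  exact ⟨q, fun a => (h a).choose_spec.2.2⟩

/-! ### Recursion on lists -/

/-- The state of a loop over a list consists of the input, the rest of the list and the
accumulated value; this program replaces it by the next state. -/
def foldBody (p : Prog) : Prog :=
  Prog.pair Prog.left (Prog.pair (Prog.comp (Prog.comp Prog.right Prog.left) Prog.right)
    (Prog.comp (Prog.pair Prog.left (Prog.pair
      (Prog.comp (Prog.comp Prog.right Prog.left) Prog.left)
      (Prog.comp Prog.right Prog.right))) p))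

def foldLoop (p : Prog) : Prog := Prog.loop (Prog.comp Prog.right Prog.left) (foldBody p)

/-- `T` bounds the cost of one step at every accumulator that actually occurs, that is, after each
prefix of the list. The total is then linear in `T` for each element. -/
theorem foldLoop_runs {p : Prog} {q : ℕ[X]} {g : α × β × σ → σ} (hg : Computes p q g) (a : α)
    (T : ℕ) (l : List β) : ∀ s : σ,
    (∀ l₁ b l₂, l = l₁ ++ b :: l₂ →
      q.eval (sz (a, b, l₁.foldl (fun s b => g (a, b, s)) s)) ≤ T) →
    ∃ t, Runs (foldLoop p) (enc (a, l, s))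
      (enc (a, ([] : List β), l.foldl (fun s b => g (a, b, s)) s)) t ∧
        t ≤ l.length * (T + 30) + 10 := by
  induction l with
  | nil =>
    intro s _
    refine ⟨_, Runs.loopDone (Runs.comp (Runs.right _) (Runs.left _)), ?_⟩
    omega
  | cons b l ih =>
    intro s hT
    obtain ⟨t, r, ht⟩ := ih (g (a, b, s)) fun l₁ b' l₂ h => by
      have := hT (b :: l₁) b' l₂ (by rw [h]; rfl)
      simpa using this
    obtain ⟨t', r', ht', -⟩ := hg (a, b, s)
    have h0 := hT [] b l rfl
    simp only [List.foldl_nil] at h0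
    refine ⟨_, Runs.loopStep (Runs.comp (Runs.right _) (Runs.left _))
      (Runs.pair (Runs.left _) (Runs.pair
        (Runs.comp (Runs.comp (Runs.right _) (Runs.left _)) (Runs.right _))
        (Runs.comp (Runs.pair (Runs.left _) (Runs.pair
          (Runs.comp (Runs.comp (Runs.right _) (Runs.left _)) (Runs.left _))
          (Runs.comp (Runs.right _) (Runs.right _)))) r'))) r, ?_⟩
    simp only [List.length_cons]
    nlinarith

/-- The bound `Q` on all intermediate accumulators is essential: a polynomial-time step could double
the accumulator each time and make it exponentially large. -/
theorem Poly.foldl {l : α → List β} {i : α → σ} {g : α × β × σ → σ} (hl : Poly l) (hi : Poly i)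
    (hg : Poly g) (Q : ℕ[X])
    (hQ : ∀ a l₁, l₁ <+: l a → sz (l₁.foldl (fun s b => g (a, b, s)) (i a)) ≤ Q.eval (sz a)) :
    Poly (fun a => (l a).foldl (fun s b => g (a, b, s)) (i a)) := by
  obtain ⟨p₀, q₀, h₀⟩ := hl
  obtain ⟨p₁, q₁, h₁⟩ := hi
  obtain ⟨p₂, q₂, h₂⟩ := hg
  refine ⟨Prog.comp (Prog.comp (Prog.pair Prog.skip (Prog.pair p₀ p₁)) (foldLoop p₂))
      (Prog.comp Prog.right Prog.right),
    q₀ + q₁ + q₀ * (q₂.comp (X + q₀ + Q + 2) + 30) + Q + 20, fun a => ?_⟩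
  obtain ⟨t₀, r₀, b₀, c₀⟩ := h₀ a
  obtain ⟨t₁, r₁, b₁, c₁⟩ := h₁ a
  obtain ⟨t, r, ht⟩ := foldLoop_runs h₂ a (q₂.eval (sz a + q₀.eval (sz a) + Q.eval (sz a) + 2))
    (l a) (i a) (by
      intro l₁ b l₂ h
      apply eval_mono
      have hb : sz b ≤ sz (l a) := sz_le_of_mem (by rw [h]; simp)
      have := hQ a l₁ ⟨_, h.symm⟩
      simp only [sz_prod]
      omega)
  have hlen := length_lt_sz (l a)
  have hfin := hQ a (l a) (List.prefix_refl _)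
  have hmul : (l a).length * (q₂.eval (sz a + q₀.eval (sz a) + Q.eval (sz a) + 2) + 30) ≤
      q₀.eval (sz a) * (q₂.eval (sz a + q₀.eval (sz a) + Q.eval (sz a) + 2) + 30) :=
    Nat.mul_le_mul_right _ (by omega)
  refine ⟨_, Runs.comp (Runs.comp (Runs.pair (Runs.skip _) (Runs.pair r₀ r₁)) r)
    (Runs.comp (Runs.right _) (Runs.right _)), ?_, ?_⟩ <;>
  simp only [eval_add, eval_mul, eval_comp, eval_X, eval_ofNat] <;> omega

theorem Poly.reverse {l : α → List β} (hl : Poly l) : Poly (fun a => (l a).reverse) := by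
  obtain ⟨q, hq⟩ := hl.exists_size_le
  have key : ∀ l₁ : List β, l₁.foldl (fun s b => b :: s) [] = l₁.reverse := fun l₁ => by
    rw [List.foldl_flip_cons_eq_append]; simp
  refine (Poly.foldl hl (Poly.nil (β := β))
    (Poly.cons (Poly.fst' Poly.snd) (Poly.snd' Poly.snd)) q ?_).congr fun a => ?_
  · intro a l₁ h
    have h3 := hq a
    have := sz_prefix_le h
    simp only [key, sz_reverse]
    omega
  · simp only [key]

theorem Poly.append {l₁ l₂ : α → List β} (h₁ : Poly l₁) (h₂ : Poly l₂) :
    Poly (fun a => l₁ a ++ l₂ a) := by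
  obtain ⟨q₁, hq₁⟩ := h₁.reverse.exists_size_le
  obtain ⟨q₂, hq₂⟩ := h₂.exists_size_le
  have key : ∀ l₁ l₂ : List β, l₁.foldl (fun s b => b :: s) l₂ = l₁.reverse ++ l₂ :=
    fun l₁ l₂ => by rw [List.foldl_flip_cons_eq_append]; simp
  refine (Poly.foldl h₁.reverse h₂
    (Poly.cons (Poly.fst' Poly.snd) (Poly.snd' Poly.snd)) (q₁ + q₂) ?_).congr fun a => ?_
  · intro a l h
    have h3 := hq₁ a
    have h4 := hq₂ a
    have := sz_prefix_le h
    have := sz_append l.reverse (l₂ a)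
    rw [sz_reverse] at this
    simp only [key, eval_add]
    omega
  · simp only [key, List.reverse_reverse]

theorem Poly.flatMap {l : α → List β} {g : α × β → List γ} (hl : Poly l) (hg : Poly g) :
    Poly (fun a => (l a).flatMap (fun b => g (a, b))) := by
  obtain ⟨q₁, hq₁⟩ := hl.exists_size_le
  obtain ⟨q₂, hq₂⟩ := hg.exists_size_le
  have key : ∀ (a : α) (l₁ : List β) (s : List γ),
      l₁.foldl (fun s b => s ++ g (a, b)) s = s ++ l₁.flatMap fun b => g (a, b) := by
    intro a l₁
    induction l₁ with
    | nil => simp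
    | cons b l ih => intro s; simp [ih]
  refine (Poly.foldl hl (Poly.nil (β := γ))
    (Poly.append (Poly.snd' Poly.snd) (hg.comp (Poly.pair Poly.fst (Poly.fst' Poly.snd))))
    (q₁ * q₂.comp (X + q₁ + 1) + 1) ?_).congr fun a => ?_
  · intro a l₁ h
    have h3 := hq₁ a
    simp only [key, List.nil_append, eval_add, eval_mul, eval_comp, eval_X, eval_one]
    have hlen := length_lt_sz (l a)
    have hl₁ : l₁.length ≤ q₁.eval (sz a) := by have := h.length_le; omega
    have hM : ∀ b ∈ l₁, sz (g (a, b)) ≤ q₂.eval (sz a + q₁.eval (sz a) + 1) := by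
      intro b hb
      have h4 := hq₂ (a, b)
      refine h4.trans (eval_mono _ ?_)
      have := sz_le_of_mem (h.subset hb)
      simp only [sz_prod]
      omega
    have gen : ∀ l₁ : List β, (∀ b ∈ l₁, sz (g (a, b)) ≤ q₂.eval (sz a + q₁.eval (sz a) + 1)) →
        sz (l₁.flatMap fun b => g (a, b)) ≤
          l₁.length * q₂.eval (sz a + q₁.eval (sz a) + 1) + 1 := by
      intro l₁
      induction l₁ with
      | nil => simp
      | cons b l ih =>
        intro h
        have h1 := ih fun b hb => h b (List.mem_cons_of_mem _ hb)
        have h2 := h b List.mem_cons_self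
        have := sz_append (g (a, b)) (l.flatMap fun b => g (a, b))
        simp only [List.flatMap_cons, List.length_cons]
        rw [Nat.add_mul]
        omega
    exact (gen l₁ hM).trans (Nat.add_le_add_right (Nat.mul_le_mul_right _ hl₁) _)
  · simp only [key, List.nil_append]

theorem Poly.map {l : α → List β} {g : α × β → γ} (hl : Poly l) (hg : Poly g) :
    Poly (fun a => (l a).map (fun b => g (a, b))) :=
  (hl.flatMap (hg.cons Poly.nil)).congr fun a => by
    simp [List.map_eq_flatMap]

theorem Poly.filter {l : α → List β} {g : α × β → Bool} (hl : Poly l) (hg : Poly g) :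
    Poly (fun a => (l a).filter (fun b => g (a, b))) :=
  (hl.flatMap (hg.cond (Poly.cons Poly.snd Poly.nil) Poly.nil)).congr fun a => by
    induction l a with
    | nil => rfl
    | cons b l ih =>
      rw [List.flatMap_cons, ih, List.filter_cons]
      cases g (a, b) <;> simp

theorem Poly.isEmpty {l : α → List β} (hl : Poly l) : Poly (fun a => (l a).isEmpty) :=
  Poly.listCases hl (Poly.const true) (Poly.const false) (fun a h => by simp [h])
    (fun a b bs h => by simp [h])

theorem Poly.not {b : α → Bool} (hb : Poly b) : Poly (fun a => !(b a)) :=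
  (hb.cond (Poly.const false) (Poly.const true)).congr fun a => by cases b a <;> rfl

theorem Poly.and {b c : α → Bool} (hb : Poly b) (hc : Poly c) : Poly (fun a => b a && c a) :=
  (hb.cond hc (Poly.const false)).congr fun a => by cases b a <;> rfl

theorem Poly.any {l : α → List β} {g : α × β → Bool} (hl : Poly l) (hg : Poly g) :
    Poly (fun a => (l a).any (fun b => g (a, b))) :=
  (hl.filter hg).isEmpty.not.congr fun a => by
    induction l a with
    | nil => rfl
    | cons b l ih =>
      rw [List.filter_cons, List.any_cons, ← ih]
      cases g (a, b) <;> simp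

theorem Poly.all {l : α → List β} {g : α × β → Bool} (hl : Poly l) (hg : Poly g) :
    Poly (fun a => (l a).all (fun b => g (a, b))) :=
  (hl.any hg.not).not.congr fun a => by
    simp [List.all_eq_not_any_not]

theorem Poly.tail {l : α → List β} (hl : Poly l) : Poly (fun a => (l a).tail) :=
  Poly.listCases hl Poly.nil (Poly.snd' Poly.snd) (fun a h => by simp [h])
    (fun a b bs h => by simp [h])

/-! ### Arithmetic in unary -/

/-- A unary number is literally a list of units, so arithmetic reduces to operations on lists:
addition to `append`, multiplication to `flatMap`, comparison to `drop`. -/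
theorem enc_replicate_unit (n : ℕ) : enc (List.replicate n ()) = enc n := by
  induction n with
  | zero => rfl
  | succ n ih => exact congrArg (BTree.node BTree.nil) ih

theorem Poly.replicateUnit {f : α → ℕ} (hf : Poly f) :
    Poly (fun a => List.replicate (f a) ()) :=
  Poly.comp (g := fun n => List.replicate n ()) (Poly.of_enc_eq enc_replicate_unit) hf

theorem Poly.lengthUnit {l : α → List Unit} (hl : Poly l) : Poly (fun a => (l a).length) := by
  refine Poly.comp (g := fun l : List Unit => l.length) (Poly.of_enc_eq fun l => ?_) hl
  rw [← enc_replicate_unit]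
  congr 1
  exact (List.eq_replicate_iff.2 ⟨rfl, fun _ _ => rfl⟩).symm

theorem Poly.length {l : α → List β} (hl : Poly l) : Poly (fun a => (l a).length) :=
  (hl.map (g := fun _ => ()) (Poly.const ())).lengthUnit.congr fun a => by simp

theorem Poly.add {f g : α → ℕ} (hf : Poly f) (hg : Poly g) : Poly (fun a => f a + g a) :=
  (hf.replicateUnit.append hg.replicateUnit).lengthUnit.congr fun a => by simp

theorem Poly.mul {f g : α → ℕ} (hf : Poly f) (hg : Poly g) : Poly (fun a => f a * g a) :=
  (hf.replicateUnit.flatMap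
    (g := fun x : α × Unit => List.replicate (g x.1) ())
    (hg.comp Poly.fst).replicateUnit).lengthUnit.congr fun a => by simp

/-- Cutting off an initial segment. -/
theorem Poly.drop {f : α → ℕ} {l : α → List β} (hf : Poly f) (hl : Poly l) :
    Poly (fun a => (l a).drop (f a)) := by
  obtain ⟨q, hq⟩ := hl.exists_size_le
  have key : ∀ (l₁ : List Unit) (l : List β),
      l₁.foldl (fun s _ => s.tail) l = l.drop l₁.length := by
    intro l₁
    induction l₁ with
    | nil => simp
    | cons b l₁ ih => intro l; simp [ih]
  refine (Poly.foldl hf.replicateUnit hl (Poly.tail (Poly.snd' Poly.snd)) q ?_).congr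
    fun a => ?_
  · intro a l₁ _
    have h3 := hq a
    simp only [key]
    have := sz_append ((l a).take l₁.length) ((l a).drop l₁.length)
    rw [List.take_append_drop] at this
    have := sz_pos ((l a).take l₁.length)
    omega
  · simp [key]

theorem Poly.lt {f g : α → ℕ} (hf : Poly f) (hg : Poly g) :
    Poly (fun a => decide (f a < g a)) :=
  (hf.drop hg.replicateUnit).isEmpty.not.congr fun a => by
    rw [List.drop_replicate]
    rcases Nat.lt_or_ge (f a) (g a) with h | h
    · obtain ⟨k, hk⟩ := Nat.exists_eq_add_of_lt h
      simp [hk, show f a + k + 1 - f a = k + 1 by omega, List.replicate_succ]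
    · simp [Nat.sub_eq_zero_of_le h, h]

theorem Poly.eqNat {f g : α → ℕ} (hf : Poly f) (hg : Poly g) :
    Poly (fun a => decide (f a = g a)) :=
  ((hf.lt hg).not.and (hg.lt hf).not).congr fun a => by
    rcases lt_trichotomy (f a) (g a) with h | h | h
    · simp [h, h.ne]
    · simp [h]
    · simp [h, h.ne']

theorem Poly.eqLiteral {f g : α → Literal} (hf : Poly f) (hg : Poly g) :
    Poly (fun a => decide (f a = g a)) :=
  ((hf.literalVar.eqNat hg.literalVar).and
    (hf.literalSign.cond hg.literalSign hg.literalSign.not)).congr fun a => by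
    rcases f a with ⟨i, b⟩
    rcases g a with ⟨j, c⟩
    cases b <;> cases c <;> simp

theorem Poly.range {f : α → ℕ} (hf : Poly f) : Poly (fun a => List.range (f a)) := by
  obtain ⟨q, hq⟩ := hf.exists_size_le
  have key : ∀ l₁ : List Unit,
      l₁.foldl (fun s _ => s ++ [s.length]) [] = List.range l₁.length := by
    intro l₁
    induction l₁ using List.reverseRecOn with
    | nil => rfl
    | append_singleton l u ih => simp [ih, List.range_succ]
  refine (Poly.foldl hf.replicateUnit (Poly.nil (β := ℕ))
    (Poly.append (Poly.snd' Poly.snd) (Poly.cons (Poly.length (Poly.snd' Poly.snd)) Poly.nil))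
    (q * (2 * q + 2) + 1) ?_).congr fun a => ?_
  · intro a l₁ h
    have h3 := hq a
    have hlen := h.length_le
    simp only [sz_nat, List.length_replicate] at h3 hlen
    simp only [key, eval_add, eval_mul, eval_ofNat, eval_one]
    refine (sz_list_le _ (2 * q.eval (sz a) + 1) ?_).trans ?_
    · intro i hi
      rw [List.mem_range] at hi
      rw [sz_nat]
      omega
    · rw [List.length_range]
      exact Nat.add_le_add_right (Nat.mul_le_mul_right _ (by omega)) _
  · simp [key]

end

/-! ### The branching step of the sparsification algorithm -/

/-- The literals over the first `n` variables. -/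
def literals (n : ℕ) : List Literal :=
  (List.range n).flatMap fun i => [(i, true), (i, false)]

/-- Adds a clause to a list of clauses, in which only the minimal clauses are kept. -/
def insertClause (Y : Clause) (S : List Clause) : List Clause :=
  if ∃ D ∈ S, D ⊆ Y then S else Y :: S.filter (fun D => ¬ Y ⊆ D)

def insertClauses (P S : List Clause) : List Clause :=
  P.foldl (fun S Y => insertClause Y S) S

/-- The lists of `h` distinct literals over the first `n` variables. -/
def candidates (n : ℕ) : ℕ → List Clause
  | 0 => [[]]
  | h + 1 => (candidates n h).flatMap fun c =>
      ((literals n).filter fun l => l ∉ c).map fun l => l :: c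

/-- The clauses of length `w` that contain `G`. -/
def family (S : List Clause) (G : Clause) (w : ℕ) : List Clause :=
  S.filter fun C => C.length = w ∧ G ⊆ C

/-- What is left of the clauses of length `w` that contain `H` when `H` is removed. -/
def petals (S : List Clause) (H : Clause) (w : ℕ) : List Clause :=
  (family S H w).map fun C => C.filter fun l => l ∉ H

/-- The number of clauses that a heart with petals of size `j` may have. -/
def threshold (K j : ℕ) : ℕ := K ^ (3 * j - 1)

/-- The pairs `(w, j)` of a clause length `w ≤ d` and a petal size `0 < j < w`, in lexicographic
order. -/
def flowerSizes (d : ℕ) : List (ℕ × ℕ) :=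
  (List.range (d + 1)).flatMap fun w => (List.range (w - 1)).map fun j => (w, j + 1)

/-- The possible hearts, with the length of the clauses and the threshold for their number. -/
def hearts (K n : ℕ) (T : List (ℕ × ℕ)) : List (Clause × ℕ × ℕ) :=
  T.flatMap fun t => (candidates n (t.1 - t.2)).map fun H => (H, t.1, threshold K t.2)

/-- The two branches for the first heart of more clauses than its threshold allows, if any. -/
def branch (K d n : ℕ) (S : List Clause) : List (List Clause) :=
  match (hearts K n (flowerSizes d)).filter
      (fun x => x.2.2 < (family S x.1 x.2.1).length) with
  | [] => []
  | x :: _ => [insertClauses [x.1] S, insertClauses (petals S x.1 x.2.1) S]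

/-! ### Polynomial running time of the branching step -/

section

variable {α β γ : Type} [Enc α] [Enc β] [Enc γ]

theorem Poly.ite {p : α → Prop} [DecidablePred p] {f g : α → β} (hp : Poly fun a => decide (p a))
    (hf : Poly f) (hg : Poly g) : Poly (fun a => if p a then f a else g a) :=
  (hp.cond hf hg).congr fun a => by by_cases h : p a <;> simp [h]

theorem Poly.literals {f : α → ℕ} (hf : Poly f) : Poly (fun a => literals (f a)) :=
  hf.range.flatMap (Poly.cons (Poly.snd.literal (Poly.const true))
    (Poly.cons (Poly.snd.literal (Poly.const false)) Poly.nil))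

theorem Poly.mem {f : α → Literal} {g : α → Clause} (hf : Poly f) (hg : Poly g) :
    Poly (fun a => decide (f a ∈ g a)) :=
  (hg.any (g := fun x : α × Literal => decide (x.2 = f x.1))
    (Poly.snd.eqLiteral (hf.comp Poly.fst))).congr fun a => by
    rw [Bool.eq_iff_iff]; simp

theorem Poly.subset {f g : α → Clause} (hf : Poly f) (hg : Poly g) :
    Poly (fun a => decide (f a ⊆ g a)) :=
  (hf.all (g := fun x : α × Literal => decide (x.2 ∈ g x.1))
    (Poly.snd.mem (hg.comp Poly.fst))).congr fun a => by
    rw [Bool.eq_iff_iff]; simp [List.subset_def]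

theorem Poly.insertClause {f : α → Clause} {g : α → List Clause} (hf : Poly f) (hg : Poly g) :
    Poly (fun a => insertClause (f a) (g a)) := by
  refine Poly.ite ?_ hg (hf.cons ?_)
  · exact (hg.any (g := fun x : α × Clause => decide (x.2 ⊆ f x.1))
      (Poly.snd.subset (hf.comp Poly.fst))).congr fun a => by
      rw [Bool.eq_iff_iff]; simp
  · exact (hg.filter (g := fun x : α × Clause => !decide (f x.1 ⊆ x.2))
      ((hf.comp Poly.fst).subset Poly.snd).not).congr fun a => by simp

theorem sz_filter_le (p : β → Bool) (l : List β) : sz (l.filter p) ≤ sz l := by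
  induction l with
  | nil => simp
  | cons b l ih =>
    rw [List.filter_cons]
    split <;> simp only [sz_cons] <;> omega

theorem sz_insertClauses_le (P S : List Clause) : sz (insertClauses P S) ≤ sz S + sz P := by
  induction P generalizing S with
  | nil => simp [insertClauses]
  | cons Y P ih =>
    have h1 := ih (QBFLower.insertClause Y S)
    have h2 : sz (QBFLower.insertClause Y S) ≤ sz S + sz Y + 1 := by
      unfold QBFLower.insertClause
      split
      · omega
      · have := sz_filter_le (fun D => decide ¬ Y ⊆ D) S
        simp only [sz_cons]
        omega
    have h3 : insertClauses (Y :: P) S = insertClauses P (QBFLower.insertClause Y S) := rfl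
    rw [h3, sz_cons]
    omega

theorem Poly.insertClauses {f g : α → List Clause} (hf : Poly f) (hg : Poly g) :
    Poly (fun a => insertClauses (f a) (g a)) := by
  obtain ⟨q, hq⟩ := hf.exists_size_le
  obtain ⟨q', hq'⟩ := hg.exists_size_le
  refine Poly.foldl hf hg (g := fun x : α × Clause × List Clause =>
    QBFLower.insertClause x.2.1 x.2.2)
    (Poly.insertClause (Poly.fst' Poly.snd) (Poly.snd' Poly.snd)) (q' + q) ?_
  intro a P hP
  have h1 := sz_insertClauses_le P (g a)
  have h2 := sz_prefix_le hP
  have := hq a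
  have := hq' a
  rw [eval_add]
  exact h1.trans (by omega)

/-- Here `h` is a constant of the program and not part of the input: there are up to `(2 * n) ^ h`
candidates, which is polynomial only for fixed `h`. -/
theorem Poly.candidates {f : α → ℕ} (hf : Poly f) (h : ℕ) :
    Poly (fun a => candidates (f a) h) := by
  induction h with
  | zero => exact Poly.const _
  | succ h ih =>
    refine ih.flatMap (g := fun x : α × Clause =>
      ((QBFLower.literals (f x.1)).filter fun l => l ∉ x.2).map fun l => l :: x.2) ?_
    refine Poly.map (g := fun y : (α × Clause) × Literal => y.2 :: y.1.2) ?_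
      (Poly.snd.cons (Poly.snd' Poly.fst))
    refine ((Poly.literals (hf.comp Poly.fst)).filter
      (g := fun y : (α × Clause) × Literal => !decide (y.2 ∈ y.1.2))
      (Poly.snd.mem (Poly.snd' Poly.fst)).not).congr fun a => by simp

theorem Poly.family {f : α → List Clause} {g : α → Clause} {w : α → ℕ} (hf : Poly f)
    (hg : Poly g) (hw : Poly w) : Poly (fun a => family (f a) (g a) (w a)) :=
  (hf.filter (g := fun x : α × Clause => decide (x.2.length = w x.1) && decide (g x.1 ⊆ x.2))
    ((Poly.snd.length.eqNat (hw.comp Poly.fst)).and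
      ((hg.comp Poly.fst).subset Poly.snd))).congr fun a => by simp [QBFLower.family]

theorem Poly.petals {f : α → List Clause} {g : α → Clause} {w : α → ℕ} (hf : Poly f)
    (hg : Poly g) (hw : Poly w) : Poly (fun a => petals (f a) (g a) (w a)) :=
  (hf.family hg hw).map (g := fun x : α × Clause => x.2.filter fun l => l ∉ g x.1)
    ((Poly.snd.filter (g := fun x : (α × Clause) × Literal => !decide (x.2 ∈ g x.1.1))
      (Poly.snd.mem (hg.comp (Poly.fst' Poly.fst))).not).congr fun a => by simp)

theorem Poly.hearts {f : α → ℕ} (hf : Poly f) (K : ℕ) (T : List (ℕ × ℕ)) :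
    Poly (fun a => hearts K (f a) T) := by
  induction T with
  | nil => exact Poly.const []
  | cons t T ih =>
    refine Poly.congr (((hf.candidates (t.1 - t.2)).map
      (g := fun x : α × Clause => (x.2, t.1, threshold K t.2))
      (Poly.snd.pair (Poly.const _))).append ih) fun a => by simp [QBFLower.hearts]

theorem Poly.branch (K d : ℕ) : Poly (fun x : ℕ × List Clause => branch K d x.1 x.2) := by
  have h1 : Poly (fun x : ℕ × List Clause => (QBFLower.hearts K x.1 (flowerSizes d)).filter
      (fun y => y.2.2 < (QBFLower.family x.2 y.1 y.2.1).length)) :=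
    (Poly.fst.hearts K (flowerSizes d)).filter
      (g := fun y : (ℕ × List Clause) × (Clause × ℕ × ℕ) =>
        decide (y.2.2.2 < (QBFLower.family y.1.2 y.2.1 y.2.2.1).length))
      ((Poly.snd' (Poly.snd' Poly.snd)).lt
        ((Poly.snd' Poly.fst).family (Poly.fst' Poly.snd)
          (Poly.fst' (Poly.snd' Poly.snd))).length)
  refine Poly.listCases (g := fun y : (ℕ × List Clause) × (Clause × ℕ × ℕ) × List _ =>
    [QBFLower.insertClauses [y.2.1.1] y.1.2,
      QBFLower.insertClauses (QBFLower.petals y.1.2 y.2.1.1 y.2.1.2.1) y.1.2]) h1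
    (Poly.const []) ?_ ?_ ?_
  · have h := Poly.fst' (β := Clause) (Poly.fst' (Poly.snd (α := ℕ × List Clause)
      (β := (Clause × ℕ × ℕ) × List (Clause × ℕ × ℕ))))
    have hS := Poly.snd' (γ := List Clause) (Poly.fst (α := ℕ × List Clause)
      (β := (Clause × ℕ × ℕ) × List (Clause × ℕ × ℕ)))
    have hw := Poly.fst' (Poly.snd' (Poly.fst' (Poly.snd (α := ℕ × List Clause)
      (β := (Clause × ℕ × ℕ) × List (Clause × ℕ × ℕ)))))
    exact (Poly.insertClauses (h.cons Poly.nil) hS).cons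
      (((hS.petals h hw).insertClauses hS).cons Poly.nil)
  · intro a h
    simp only [QBFLower.branch, h]
  · intro a b bs h
    simp only [QBFLower.branch, h]

end

/-! ### Satisfiability of the branches -/

theorem MatrixHolds.of_subset {a : ℕ → Bool} {Y D : Clause} (h : D ⊆ Y)
    (hD : ∃ l ∈ D, Literal.Holds a l) : ∃ l ∈ Y, Literal.Holds a l := by
  obtain ⟨l, hl, ha⟩ := hD
  exact ⟨l, h hl, ha⟩

theorem matrixHolds_insertClause (a : ℕ → Bool) (Y : Clause) (S : List Clause) :
    MatrixHolds a (insertClause Y S) ↔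
      (∃ l ∈ Y, Literal.Holds a l) ∧ MatrixHolds a S := by
  unfold insertClause
  split
  · next h =>
    obtain ⟨D, hD, hDY⟩ := h
    exact ⟨fun hS => ⟨MatrixHolds.of_subset hDY (hS D hD), hS⟩, fun h => h.2⟩
  · constructor
    · intro h
      have hY := h Y List.mem_cons_self
      refine ⟨hY, fun C hC => ?_⟩
      by_cases hYC : Y ⊆ C
      · exact MatrixHolds.of_subset hYC hY
      · exact h C (List.mem_cons_of_mem _ (List.mem_filter.2 ⟨hC, by simpa using hYC⟩))
    · rintro ⟨hY, hS⟩ C hC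
      rcases List.mem_cons.1 hC with rfl | hC
      · exact hY
      · exact hS C (List.mem_filter.1 hC).1

theorem matrixHolds_insertClauses (a : ℕ → Bool) (P S : List Clause) :
    MatrixHolds a (insertClauses P S) ↔ MatrixHolds a P ∧ MatrixHolds a S := by
  induction P generalizing S with
  | nil => simp [insertClauses, MatrixHolds]
  | cons Y P ih =>
    have h3 : insertClauses (Y :: P) S = insertClauses P (insertClause Y S) := rfl
    rw [h3, ih, matrixHolds_insertClause]
    simp only [MatrixHolds, List.forall_mem_cons]
    tauto

/-- If no literal of `H` is true, then every clause containing `H` is satisfied by a literal outside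
`H`, that is, by its petal. Conversely, both branches still imply `S`. -/
theorem matrixHolds_iff_heart_or_petals (a : ℕ → Bool) (S : List Clause) (H : Clause) (w : ℕ) :
    MatrixHolds a S ↔ MatrixHolds a (insertClauses [H] S) ∨
      MatrixHolds a (insertClauses (petals S H w) S) := by
  rw [matrixHolds_insertClauses, matrixHolds_insertClauses]
  constructor
  · intro h
    by_cases hH : ∃ l ∈ H, Literal.Holds a l
    · left
      exact ⟨by simpa [MatrixHolds] using hH, h⟩
    · right
      refine ⟨fun C hC => ?_, h⟩
      simp only [petals, List.mem_map, family, List.mem_filter] at hC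
      obtain ⟨D, ⟨hD, -⟩, rfl⟩ := hC
      obtain ⟨l, hl, ha⟩ := h D hD
      refine ⟨l, ?_, ha⟩
      rw [List.mem_filter]
      refine ⟨hl, ?_⟩
      have : l ∉ H := fun hlH => hH ⟨l, hlH, ha⟩
      simpa using this
  · rintro (h | h) <;> exact h.2

/-! ### Degrees of hearts -/

theorem mem_literals {n : ℕ} {l : Literal} : l ∈ literals n ↔ l.1 < n := by
  rcases l with ⟨i, b⟩
  cases b <;> simp [literals]

theorem length_literals (n : ℕ) : (literals n).length = 2 * n := by
  simp [literals, mul_comm]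

theorem mem_candidates {n h : ℕ} {H : Clause} :
    H ∈ candidates n h ↔ H.Nodup ∧ H.length = h ∧ ∀ l ∈ H, l.1 < n := by
  induction h generalizing H with
  | zero =>
    simp only [candidates, List.mem_singleton, List.length_eq_zero_iff]
    constructor
    · rintro rfl; simp
    · exact fun h => h.2.1
  | succ h ih =>
    simp only [candidates, List.mem_flatMap, List.mem_map, List.mem_filter, mem_literals, ih,
      decide_eq_true_eq]
    constructor
    · rintro ⟨c, ⟨h1, h2, h3⟩, l, ⟨h4, h5⟩, rfl⟩
      exact ⟨List.nodup_cons.2 ⟨h5, h1⟩, by simp [h2], List.forall_mem_cons.2 ⟨h4, h3⟩⟩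
    · rintro ⟨h1, h2, h3⟩
      cases H with
      | nil => simp at h2
      | cons l c =>
        rw [List.nodup_cons] at h1
        rw [List.forall_mem_cons] at h3
        exact ⟨c, ⟨h1.2, by simpa using h2, h3.2⟩, l, ⟨h3.1, h1.1⟩, rfl⟩

/-- The number of clauses of length `s` that contain `G`. -/
def degree (S : List Clause) (s : ℕ) (G : Clause) : ℕ := (family S G s).length

theorem degree_nil (s : ℕ) (G : Clause) : degree [] s G = 0 := rfl

theorem degree_cons (C : Clause) (S : List Clause) (s : ℕ) (G : Clause) :
    degree (C :: S) s G = (if C.length = s ∧ G ⊆ C then 1 else 0) + degree S s G := by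
  unfold degree family
  rw [List.filter_cons]
  by_cases h : C.length = s ∧ G ⊆ C
  · simp [h, add_comm]
  · simp [h]

theorem degree_mono {L S : List Clause} (h : L.Sublist S) (s : ℕ) (G : Clause) :
    degree L s G ≤ degree S s G :=
  (h.filter _).length_le

theorem degree_eq_zero {S : List Clause} {s : ℕ} {G : Clause}
    (h : ∀ C ∈ S, C.length = s → ¬ G ⊆ C) : degree S s G = 0 := by
  unfold degree family
  rw [List.length_eq_zero_iff, List.filter_eq_nil_iff]
  intro C hC
  simpa using h C hC

/-- The balance of one insertion: the clauses of length `s` lose those that contain `Y`, and gain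
`Y` if it has that length. -/
theorem degree_cons_filter (Y : Clause) (L : List Clause) (s : ℕ) :
    degree (Y :: L.filter fun D => ¬ Y ⊆ D) s [] + degree L s Y =
      (if Y.length = s then 1 else 0) + degree L s [] := by
  rw [degree_cons]
  have : degree (L.filter fun D => ¬ Y ⊆ D) s [] + degree L s Y = degree L s [] := by
    induction L with
    | nil => rfl
    | cons C L ih =>
      rw [List.filter_cons, degree_cons C L s Y, degree_cons C L s []]
      by_cases h : Y ⊆ C
      · simp only [h, not_true_eq_false, decide_false, Bool.false_eq_true, if_false, and_true,
          List.nil_subset]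
        omega
      · simp only [h, not_false_eq_true, decide_true, if_true, and_false, if_false,
          degree_cons, List.nil_subset, and_true]
        omega
  simp only [List.nil_subset, and_true]
  omega

theorem subset_of_subset_of_length_le {G C : Clause} (hG : G.Nodup) (h : G ⊆ C)
    (hl : C.length ≤ G.length) : C ⊆ G :=
  ((List.subperm_of_subset hG h).perm_of_length_le hl).symm.subset

/-- Every clause of positive length is counted at least once by one of its literals. Hence bounds on
the degrees of single literals bound the number of clauses. -/
theorem degree_nil_le_sum {n s : ℕ} {L : List Clause} (hs : 1 ≤ s)
    (hL : ∀ C ∈ L, ∀ l ∈ C, l.1 < n) :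
    degree L s [] ≤ ((literals n).map fun l => degree L s [l]).sum := by
  induction L with
  | nil => simp [degree_nil]
  | cons C L ih =>
    have h1 := ih fun D hD => hL D (List.mem_cons_of_mem _ hD)
    simp only [degree_cons, List.sum_map_add]
    refine Nat.add_le_add ?_ h1
    by_cases hC : C.length = s
    · obtain ⟨l, hl⟩ := List.exists_mem_of_length_pos (by omega : 0 < C.length)
      have hmem : l ∈ literals n := mem_literals.2 (hL C List.mem_cons_self l hl)
      have := List.single_le_sum (l := (literals n).map fun l =>
        if C.length = s ∧ [l] ⊆ C then 1 else 0) (fun _ _ => Nat.zero_le _)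
        (if C.length = s ∧ [l] ⊆ C then 1 else 0) (List.mem_map_of_mem hmem)
      refine le_trans ?_ this
      simp [hC, hl]
    · simp [hC]

theorem degree_nil_le {n s M : ℕ} {L : List Clause} (hs : 1 ≤ s)
    (hL : ∀ C ∈ L, ∀ l ∈ C, l.1 < n) (hM : ∀ l : Literal, degree L s [l] ≤ M) :
    degree L s [] ≤ 2 * n * M := by
  refine (degree_nil_le_sum hs hL).trans ?_
  refine (List.sum_le_card_nsmul _ M ?_).trans ?_
  · intro x hx
    obtain ⟨l, -, rfl⟩ := List.mem_map.1 hx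
    exact hM l
  · simp [length_literals]

/-! ### Antichains of clauses -/

/-- The clause has no repeated literals, at most `d` literals, and variables below `n`. -/
def ClauseWithin (n d : ℕ) (C : Clause) : Prop :=
  C.Nodup ∧ C.length ≤ d ∧ ∀ l ∈ C, l.1 < n

/-- Neither clause contains the other. -/
def Incomparable (C D : Clause) : Prop := ¬ C ⊆ D ∧ ¬ D ⊆ C

instance : Std.Symm Incomparable := ⟨fun _ _ h => ⟨h.2, h.1⟩⟩

/-- A list of pairwise incomparable clauses of length at most `d` over `n` variables. -/
structure Antichain (n d : ℕ) (S : List Clause) : Prop where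
  within : ∀ C ∈ S, ClauseWithin n d C
  pairwise : S.Pairwise Incomparable

theorem Antichain.cons_filter {n d : ℕ} {S : List Clause} (hS : Antichain n d S) {Y : Clause}
    (hY : ClauseWithin n d Y) (h : ∀ D ∈ S, ¬ D ⊆ Y) :
    Antichain n d (Y :: S.filter fun D => ¬ Y ⊆ D) := by
  refine ⟨?_, List.pairwise_cons.2 ⟨?_, hS.pairwise.filter _⟩⟩
  · rw [List.forall_mem_cons]
    exact ⟨hY, fun C hC => hS.within C (List.mem_filter.1 hC).1⟩
  · intro D hD
    rw [List.mem_filter] at hD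
    exact ⟨by simpa using hD.2, h D hD.1⟩

theorem Antichain.insertClause {n d : ℕ} {S : List Clause} (hS : Antichain n d S) {Y : Clause}
    (hY : ClauseWithin n d Y) : Antichain n d (insertClause Y S) := by
  unfold QBFLower.insertClause
  split
  · exact hS
  · next h => exact hS.cons_filter hY fun D hD hDY => h ⟨D, hD, hDY⟩

theorem Antichain.insertClauses {n d : ℕ} {P S : List Clause} (hS : Antichain n d S)
    (hP : ∀ Y ∈ P, ClauseWithin n d Y) : Antichain n d (insertClauses P S) := by
  induction P generalizing S with
  | nil => exact hS
  | cons Y P ih =>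
    rw [List.forall_mem_cons] at hP
    exact ih (hS.insertClause hP.1) hP.2

theorem Antichain.eq_of_subset {n d : ℕ} {S : List Clause} (hS : Antichain n d S)
    {C D : Clause} (hC : C ∈ S) (hD : D ∈ S) (h : C ⊆ D) : C = D := by
  by_contra hne
  exact (hS.pairwise.forall hC hD hne).1 h

theorem length_le_one_of_pairwise {S : List Clause} (hS : S.Pairwise Incomparable)
    (h : ∀ C ∈ S, ∀ D ∈ S, C ⊆ D) : S.length ≤ 1 := by
  match S, hS, h with
  | [], _, _ => simp
  | [_], _, _ => simp
  | C :: D :: S, hS, h =>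
    exact absurd (h C (by simp) D (by simp)) ((List.pairwise_cons.1 hS).1 D (by simp)).1

/-- A clause of length `G.length` that contains `G` has the same literals as `G`, and an antichain
holds at most one such clause. -/
theorem degree_le_one {S : List Clause} (hS : S.Pairwise Incomparable) {s : ℕ} {G : Clause}
    (hG : G.Nodup) (hs : G.length = s) : degree S s G ≤ 1 := by
  refine length_le_one_of_pairwise (hS.filter _) fun C hC D hD => ?_
  simp only [family, List.mem_filter, decide_eq_true_eq] at hC hD
  exact List.Subset.trans (subset_of_subset_of_length_le hG hC.2.2 (by omega)) hD.2.2

/-! ### The invariant of the sparsification algorithm -/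

/-- In the list `S` of the current clauses, `L` lists those that were added by the algorithm, and
`a s` is the number of clauses of length `s` that have ever been added, possibly to be superseded
later by a smaller clause. -/
structure SparsifyInv (K d n m : ℕ) (S L : List Clause) (a : ℕ → ℕ) : Prop where
  antichain : Antichain n d S
  sublist : L.Sublist S
  degree_le : ∀ (s : ℕ) (G : Clause), G.Nodup → 1 ≤ G.length → G.length ≤ s →
    degree L s G ≤ 2 * threshold K (s - G.length)
  added_le : ∀ s, a s ≤ degree L s [] + ∑ r ∈ Finset.Ico 1 s, 2 * a r * threshold K (s - r)
  length_le : S.length ≤ m + ∑ r ∈ Finset.Ico 1 d, a r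

theorem SparsifyInv.initial {K d n : ℕ} {S : List Clause} (hS : Antichain n d S) :
    SparsifyInv K d n S.length S [] fun _ => 0 where
  antichain := hS
  sublist := List.nil_sublist _
  degree_le := by simp [degree_nil]
  added_le := by simp
  length_le := by simp

/-- Strong induction on the length. The added clauses still present are bounded through the degrees
of single literals, and those superseded by a clause of length `r < s` through the induction
hypothesis for `r`. All in all there are at most `2 * (s - 1) + 4` terms of size `n * K ^ (3 * s -
3)`, and one factor `K` absorbs their number. -/
theorem SparsifyInv.added_le_pow {K d n m : ℕ} {S L : List Clause} {a : ℕ → ℕ}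
    (h : SparsifyInv K d n m S L a) (hK : 2 * d + 4 ≤ K) (s : ℕ) (hs : 1 ≤ s) (hsd : s ≤ d) :
    a s ≤ n * K ^ (3 * s - 2) := by
  induction s using Nat.strong_induction_on with
  | _ s ih =>
    have hK0 : 1 ≤ K := by omega
    have h1 : degree L s [] ≤ 2 * n * (2 * threshold K (s - 1)) :=
      degree_nil_le hs (fun C hC => (h.antichain.within C (h.sublist.subset hC)).2.2)
        fun l => h.degree_le s [l] (by simp) (by simp) (by simpa using hs)
    have h2 : ∀ r ∈ Finset.Ico 1 s, 2 * a r * threshold K (s - r) ≤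
        2 * n * K ^ (3 * s - 3) := by
      intro r hr
      rw [Finset.mem_Ico] at hr
      have := ih r hr.2 hr.1 (by omega)
      calc 2 * a r * threshold K (s - r)
          ≤ 2 * (n * K ^ (3 * r - 2)) * threshold K (s - r) := by gcongr
        _ = 2 * n * (K ^ (3 * r - 2) * K ^ (3 * (s - r) - 1)) := by
          rw [threshold]; ring
        _ = 2 * n * K ^ (3 * s - 3) := by
          -- The exponents `3 * r - 2` and `3 * (s - r) - 1` add up to `3 * s - 3`, whatever `r` is;
          -- the exponent in `threshold` is chosen for this.
          rw [← pow_add]; congr 2; omega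
    have h3 := Finset.sum_le_sum h2
    rw [Finset.sum_const, Nat.card_Ico, smul_eq_mul] at h3
    have h4 : threshold K (s - 1) ≤ K ^ (3 * s - 3) :=
      Nat.pow_le_pow_right hK0 (by omega)
    have h5 : K ^ (3 * s - 2) = K * K ^ (3 * s - 3) := by
      rw [← pow_succ']; congr 1; omega
    have h6 := h.added_le s
    calc a s ≤ 2 * n * (2 * K ^ (3 * s - 3)) + (s - 1) * (2 * n * K ^ (3 * s - 3)) := by
          refine h6.trans (Nat.add_le_add (h1.trans ?_) h3)
          gcongr
      _ = (2 * (s - 1) + 4) * (n * K ^ (3 * s - 3)) := by ring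
      _ ≤ K * (n * K ^ (3 * s - 3)) := Nat.mul_le_mul_right _ (by omega)
      _ = n * K ^ (3 * s - 2) := by rw [h5]; ring

/-- The clauses in `P` are added, and supersede all clauses containing them. -/
def pushClauses (P L : List Clause) : List Clause :=
  P.foldl (fun L Y => Y :: L.filter fun D => ¬ Y ⊆ D) L

/-- By `hPS` no new clause is discarded as redundant, so each one counts. The degree bound is
assumed only for lengths other than `r`: clauses of length `r` are never superseded here, so the
induction need not maintain a bound for them. -/
theorem SparsifyInv.insertClauses_aux {K d n m r : ℕ} (hr : 1 ≤ r) (hrd : r < d)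
    {P : List Clause} (hP : ∀ Y ∈ P, ClauseWithin n d Y ∧ Y.length = r)
    (hPP : P.Pairwise Incomparable) {S L : List Clause} {a : ℕ → ℕ}
    (hPS : ∀ Y ∈ P, ∀ D ∈ S, ¬ D ⊆ Y) (hS : Antichain n d S) (hL : L.Sublist S)
    (hdeg : ∀ (s : ℕ) (G : Clause), G.Nodup → 1 ≤ G.length → G.length ≤ s → s ≠ r →
      degree L s G ≤ 2 * threshold K (s - G.length))
    (hadd : ∀ s, a s ≤ degree L s [] + ∑ i ∈ Finset.Ico 1 s, 2 * a i * threshold K (s - i))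
    (hlen : S.length ≤ m + ∑ i ∈ Finset.Ico 1 d, a i) :
    Antichain n d (insertClauses P S) ∧ (pushClauses P L).Sublist (insertClauses P S) ∧
    (∀ (s : ℕ) (G : Clause), s ≠ r → degree (pushClauses P L) s G ≤ degree L s G) ∧
    (∀ G : Clause, degree (pushClauses P L) r G ≤ degree L r G + degree P r G) ∧
    (∀ s, Function.update a r (a r + P.length) s ≤ degree (pushClauses P L) s [] +
      ∑ i ∈ Finset.Ico 1 s,
        2 * Function.update a r (a r + P.length) i * threshold K (s - i)) ∧
    (insertClauses P S).length ≤
      m + ∑ i ∈ Finset.Ico 1 d, Function.update a r (a r + P.length) i := by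
  induction P generalizing S L a with
  | nil =>
    simp only [List.length_nil, add_zero, Function.update_eq_self]
    exact ⟨hS, hL, fun s G _ => le_rfl, fun G => le_rfl, hadd, hlen⟩
  | cons Y P ih =>
    rw [List.forall_mem_cons] at hP hPS
    obtain ⟨⟨hY, hYr⟩, hP⟩ := hP
    obtain ⟨hYS, hPS⟩ := hPS
    rw [List.pairwise_cons] at hPP
    have e1 : insertClauses (Y :: P) S =
        insertClauses P (Y :: S.filter fun D => ¬ Y ⊆ D) := by
      change insertClauses P (insertClause Y S) = _
      unfold insertClause
      rw [if_neg]
      rintro ⟨D, hD, hDY⟩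
      exact hYS D hD hDY
    have e2 : pushClauses (Y :: P) L = pushClauses P (Y :: L.filter fun D => ¬ Y ⊆ D) := rfl
    have e3 : Function.update a r (a r + (Y :: P).length) =
        Function.update (Function.update a r (a r + 1)) r
          (Function.update a r (a r + 1) r + P.length) := by
      simp only [Function.update_idem, Function.update_self, List.length_cons]
      congr 1; ring
    have hsub : ∀ (s : ℕ) (G : Clause),
        degree (L.filter fun D => ¬ Y ⊆ D) s G ≤ degree L s G :=
      degree_mono List.filter_sublist
    rw [e1, e2, e3]
    have key := ih (S := Y :: S.filter fun D => ¬ Y ⊆ D)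
      (L := Y :: L.filter fun D => ¬ Y ⊆ D) (a := Function.update a r (a r + 1)) hP hPP.2
      ?_ (hS.cons_filter hY hYS) ((hL.filter _).cons_cons _) ?_ ?_ ?_
    · obtain ⟨k1, k2, k3, k4, k5, k6⟩ := key
      refine ⟨k1, k2, fun s G hs => (k3 s G hs).trans ?_, fun G => (k4 G).trans ?_, k5, k6⟩
      · rw [degree_cons, if_neg (by omega), zero_add]
        exact hsub s G
      · rw [degree_cons, degree_cons]
        have := hsub r G
        omega
    · intro Y' hY' D hD
      rcases List.mem_cons.1 hD with rfl | hD
      · exact (hPP.1 Y' hY').1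
      · exact hPS Y' hY' D (List.mem_filter.1 hD).1
    · intro s G h1 h2 h3 h4
      rw [degree_cons, if_neg (by omega), zero_add]
      exact (hsub s G).trans (hdeg s G h1 h2 h3 h4)
    · intro s
      have h0 := degree_cons_filter Y L s
      rcases lt_trichotomy s r with hs | rfl | hs
      · have hz : degree L s Y = 0 := degree_eq_zero fun C hC hCs hYC => by
          have := (List.subperm_of_subset hY.1 hYC).length_le
          omega
        have hsum : ∑ i ∈ Finset.Ico 1 s,
            2 * Function.update a r (a r + 1) i * threshold K (s - i) =
            ∑ i ∈ Finset.Ico 1 s, 2 * a i * threshold K (s - i) := by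
          refine Finset.sum_congr rfl fun i hi => ?_
          rw [Finset.mem_Ico] at hi
          rw [Function.update_of_ne (by omega)]
        rw [Function.update_of_ne hs.ne, hsum]
        have := hadd s
        rw [if_neg (by omega)] at h0
        omega
      -- A clause of the same length containing `Y` would also be contained in `Y`, which `hYS`
      -- excludes.
      · have hz : degree L s Y = 0 := degree_eq_zero fun C hC hCs hYC =>
          hYS C (hL.subset hC) (subset_of_subset_of_length_le hY.1 hYC (by omega))
        have hsum : ∑ i ∈ Finset.Ico 1 s,
            2 * Function.update a s (a s + 1) i * threshold K (s - i) =
            ∑ i ∈ Finset.Ico 1 s, 2 * a i * threshold K (s - i) := by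
          refine Finset.sum_congr rfl fun i hi => ?_
          rw [Finset.mem_Ico] at hi
          rw [Function.update_of_ne (by omega)]
        rw [Function.update_self, hsum]
        have := hadd s
        rw [if_pos hYr] at h0
        omega
      -- The new clause supersedes at most this many added clauses of length `s`; the sum in
      -- `added_le` grows by exactly this amount when `a r` grows by one.
      · have hz : degree L s Y ≤ 2 * threshold K (s - r) := by
          have := hdeg s Y hY.1 (by omega) (by omega) (by omega)
          rwa [hYr] at this
        have hmem : r ∈ Finset.Ico 1 s := Finset.mem_Ico.2 ⟨hr, hs⟩
        have hsum : ∑ i ∈ Finset.Ico 1 s,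
            2 * Function.update a r (a r + 1) i * threshold K (s - i) =
            ∑ i ∈ Finset.Ico 1 s, 2 * a i * threshold K (s - i) +
              2 * threshold K (s - r) := by
          rw [← Finset.add_sum_erase _ _ hmem, ← Finset.add_sum_erase _ _ hmem,
            Function.update_self, Finset.sum_congr rfl fun i hi => by
              rw [Function.update_of_ne (Finset.ne_of_mem_erase hi)]]
          ring
        rw [Function.update_of_ne hs.ne', hsum]
        have := hadd s
        rw [if_neg (by omega)] at h0
        omega
    · have hmem : r ∈ Finset.Ico 1 d := Finset.mem_Ico.2 ⟨hr, hrd⟩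
      have hsum : ∑ i ∈ Finset.Ico 1 d, Function.update a r (a r + 1) i =
          ∑ i ∈ Finset.Ico 1 d, a i + 1 := by
        rw [← Finset.add_sum_erase _ _ hmem, ← Finset.add_sum_erase _ _ hmem,
          Function.update_self, Finset.sum_congr rfl fun i hi => by
            rw [Function.update_of_ne (Finset.ne_of_mem_erase hi)]]
        ring
      have := List.length_filter_le (fun D => decide ¬ Y ⊆ D) S
      rw [hsum, List.length_cons]
      omega

/-- The factor `2` in the degree bound arises here: among the clauses of length `r`, the old ones
and the new ones each respect the threshold. For other lengths the degrees do not increase. -/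
theorem SparsifyInv.insertClauses {K d n m r : ℕ} {S L : List Clause} {a : ℕ → ℕ}
    (h : SparsifyInv K d n m S L a) (hr : 1 ≤ r) (hrd : r < d)
    {P : List Clause} (hP : ∀ Y ∈ P, ClauseWithin n d Y ∧ Y.length = r)
    (hPP : P.Pairwise Incomparable) (hPS : ∀ Y ∈ P, ∀ D ∈ S, ¬ D ⊆ Y)
    (hS : ∀ G : Clause, G.Nodup → 1 ≤ G.length → G.length ≤ r →
      degree S r G ≤ threshold K (r - G.length))
    (hPdeg : ∀ G : Clause, G.Nodup → 1 ≤ G.length → G.length ≤ r →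
      degree P r G ≤ threshold K (r - G.length)) :
    SparsifyInv K d n m (insertClauses P S) (pushClauses P L)
      (Function.update a r (a r + P.length)) := by
  obtain ⟨k1, k2, k3, k4, k5, k6⟩ := SparsifyInv.insertClauses_aux (K := K) (m := m) hr hrd hP
    hPP hPS h.antichain h.sublist (fun s G h1 h2 h3 _ => h.degree_le s G h1 h2 h3) h.added_le
    h.length_le
  refine ⟨k1, k2, fun s G h1 h2 h3 => ?_, k5, k6⟩
  by_cases hs : s = r
  · subst hs
    have := k4 G
    have := degree_mono h.sublist s G
    have := hS G h1 h2 h3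
    have := hPdeg G h1 h2 h3
    omega
  · exact (k3 s G hs).trans (h.degree_le s G h1 h2 h3)

/-! ### Light and heavy hearts -/

theorem mem_flowerSizes {d w j : ℕ} : (w, j) ∈ flowerSizes d ↔ w ≤ d ∧ 1 ≤ j ∧ j < w := by
  simp only [flowerSizes, List.mem_flatMap, List.mem_range, List.mem_map, Prod.mk.injEq]
  constructor
  · rintro ⟨w', h1, j', h2, rfl, rfl⟩; omega
  · rintro ⟨h1, h2, h3⟩
    exact ⟨w, by omega, j - 1, by omega, rfl, by omega⟩

theorem pairwise_flowerSizes (d : ℕ) :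
    (flowerSizes d).Pairwise fun t u => t.1 < u.1 ∨ t.1 = u.1 ∧ t.2 < u.2 := by
  unfold flowerSizes
  rw [List.pairwise_flatMap]
  constructor
  · intro w _
    rw [List.pairwise_map]
    exact (List.pairwise_lt_range).imp fun h => Or.inr ⟨rfl, by omega⟩
  · refine (List.pairwise_lt_range).imp fun {w w'} h x hx y hy => ?_
    obtain ⟨i, -, rfl⟩ := List.mem_map.1 hx
    obtain ⟨j, -, rfl⟩ := List.mem_map.1 hy
    exact Or.inl h

theorem exists_of_filter_flatMap_eq_cons {α β : Type} (p : β → Bool) (f : α → List β)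
    (T : List α) (x : β) (xs : List β) (h : (T.flatMap f).filter p = x :: xs) :
    ∃ T₁ t T₂, T = T₁ ++ t :: T₂ ∧ x ∈ f t ∧ p x = true ∧
      ∀ u ∈ T₁, ∀ y ∈ f u, p y = false := by
  induction T with
  | nil => simp at h
  | cons t T ih =>
    rw [List.flatMap_cons, List.filter_append] at h
    cases ht : (f t).filter p with
    | nil =>
      rw [ht, List.nil_append] at h
      obtain ⟨T₁, u, T₂, rfl, h1, h2, h3⟩ := ih h
      refine ⟨t :: T₁, u, T₂, rfl, h1, h2, ?_⟩
      rw [List.forall_mem_cons]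
      refine ⟨fun y hy => ?_, h3⟩
      simpa using List.filter_eq_nil_iff.1 ht y hy
    | cons y ys =>
      rw [ht, List.cons_append, List.cons.injEq] at h
      have hx : x ∈ (f t).filter p := by rw [ht, h.1]; exact List.mem_cons_self
      rw [List.mem_filter] at hx
      exact ⟨[], t, T, rfl, hx.1, hx.2, by simp⟩

/-- The algorithm only inspects hearts over the `n` variables that are shorter than the clauses.
Other variables give degree `0`. For a heart of full length, truncated subtraction makes `threshold
K 0` equal to `1`, which is what an antichain allows. -/
theorem Antichain.degree_le_of_candidates {K n d : ℕ} {S : List Clause} (hS : Antichain n d S)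
    {s : ℕ} {G : Clause} (hG : G.Nodup) (hGs : G.length ≤ s)
    (h : G.length < s → ∀ G' ∈ candidates n G.length,
      degree S s G' ≤ threshold K (s - G.length)) :
    degree S s G ≤ threshold K (s - G.length) := by
  rcases hGs.eq_or_lt with hs | hs
  · rw [hs, Nat.sub_self]
    exact degree_le_one hS.pairwise hG hs
  · by_cases hn : ∀ l ∈ G, l.1 < n
    · exact h hs G (mem_candidates.2 ⟨hG, rfl, hn⟩)
    · rw [degree_eq_zero]
      · exact Nat.zero_le _
      · intro C hC _ hGC
        exact hn fun l hl => (hS.within C hC).2.2 l (hGC hl)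

theorem degree_le_of_branch_eq_nil {K d n : ℕ} {S : List Clause} (hS : Antichain n d S)
    (h : branch K d n S = []) {s : ℕ} (hs : s ≤ d) {G : Clause} (hG : G.Nodup)
    (hG1 : 1 ≤ G.length) (hGs : G.length ≤ s) :
    degree S s G ≤ threshold K (s - G.length) := by
  refine hS.degree_le_of_candidates hG hGs fun hlt G' hG' => ?_
  unfold branch at h
  split at h
  · next hf =>
    rw [List.filter_eq_nil_iff] at hf
    have := hf (G', s, threshold K (s - G.length)) (by
      simp only [hearts, List.mem_flatMap, List.mem_map]
      refine ⟨(s, s - G.length), mem_flowerSizes.2 ⟨hs, by omega, by omega⟩, G', ?_, rfl⟩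
      rwa [Nat.sub_sub_self hGs])
    simpa [degree] using this
  · simp at h

/-- The heart `H` is contained in many clauses of length `w`, and no heart that precedes it is. -/
structure IsFirstHeart (K d n : ℕ) (S : List Clause) (H : Clause) (w j : ℕ) : Prop where
  one_le : 1 ≤ j
  lt : j < w
  le : w ≤ d
  nodup : H.Nodup
  length_eq : H.length = w - j
  threshold_lt : threshold K j < degree S w H
  light_of_lt : ∀ (s : ℕ) (G : Clause), s < w → G.Nodup → 1 ≤ G.length → G.length ≤ s →
    degree S s G ≤ threshold K (s - G.length)
  light : ∀ G : Clause, G.Nodup → w - j < G.length → G.length ≤ w →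
    degree S w G ≤ threshold K (w - G.length)

/-- The hearts are listed in lexicographic order of clause length and petal size. Hence everything
with shorter clauses is light, and so is everything with clauses of length `w` and smaller petals,
that is, larger hearts. -/
theorem exists_isFirstHeart {K d n : ℕ} {S : List Clause} (hS : Antichain n d S)
    (h : branch K d n S ≠ []) : ∃ (H : Clause) (w j : ℕ), IsFirstHeart K d n S H w j ∧
      branch K d n S = [insertClauses [H] S, insertClauses (petals S H w) S] := by
  cases hf : (hearts K n (flowerSizes d)).filter
      (fun x => x.2.2 < (family S x.1 x.2.1).length) with
  | nil =>
    refine absurd ?_ h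
    simp only [branch, hf]
  | cons x xs =>
    have hb : branch K d n S =
        [insertClauses [x.1] S, insertClauses (petals S x.1 x.2.1) S] := by
      simp only [branch, hf]
    obtain ⟨T₁, ⟨w, j⟩, T₂, hT, hx, hp, hlight⟩ :=
      exists_of_filter_flatMap_eq_cons _ _ _ _ _ hf
    obtain ⟨H, hH, rfl⟩ := List.mem_map.1 hx
    obtain ⟨hwd, hj, hjw⟩ := mem_flowerSizes.1
      (show (w, j) ∈ flowerSizes d by rw [hT]; simp)
    obtain ⟨hH1, hH2, -⟩ := mem_candidates.1 hH
    have key : ∀ (s : ℕ) (G : Clause), G.Nodup → 1 ≤ G.length → G.length ≤ s →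
        (s < w ∨ s = w ∧ s - G.length < j) → degree S s G ≤ threshold K (s - G.length) := by
      intro s G hG hG1 hGs hlex
      refine hS.degree_le_of_candidates hG hGs fun hlt G' hG' => ?_
      have hmem : (s, s - G.length) ∈ flowerSizes d :=
        mem_flowerSizes.2 ⟨by omega, by omega, by omega⟩
      have hpw := pairwise_flowerSizes d
      rw [hT] at hmem hpw
      have hT₁ : (s, s - G.length) ∈ T₁ := by
        rcases List.mem_append.1 hmem with hm | hm
        · exact hm
        · exfalso
          rcases List.mem_cons.1 hm with hm | hm
          · rw [Prod.mk.injEq] at hm; omega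
          · have := (List.pairwise_cons.1 (List.pairwise_append.1 hpw).2.1).1 _ hm
            simp only at this
            omega
      have := hlight _ hT₁ (G', s, threshold K (s - G.length)) (List.mem_map.2 ⟨G', by
        simpa only [Nat.sub_sub_self hGs] using hG', rfl⟩)
      simpa [degree] using this
    refine ⟨H, w, j, ⟨hj, hjw, hwd, hH1, hH2, by simpa [degree] using hp, ?_, ?_⟩, hb⟩
    · exact fun s G h1 h2 h3 h4 => key s G h2 h3 h4 (Or.inl h1)
    · exact fun G h1 h2 h3 => key w G h1 (by omega) h3 (Or.inr ⟨rfl, by omega⟩)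

theorem length_filter_notMem {H C : Clause} (hH : H.Nodup) (hC : C.Nodup) (h : H ⊆ C) :
    (C.filter fun l => l ∉ H).length = C.length - H.length := by
  have h1 : (C.filter fun l => l ∈ H).length = H.length := by
    refine List.Perm.length_eq ?_
    rw [List.perm_ext_iff_of_nodup (hC.filter _) hH]
    intro l
    simp only [List.mem_filter, decide_eq_true_eq]
    exact ⟨fun h => h.2, fun hl => ⟨h hl, hl⟩⟩
  have h2 := List.length_eq_length_filter_add (l := C) fun l => decide (l ∈ H)
  have h3 : (fun l => decide (l ∉ H)) = fun l => !decide (l ∈ H) := by ext l; simp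
  rw [h3]
  omega

theorem threshold_pos {K : ℕ} (hK : 1 ≤ K) (j : ℕ) : 1 ≤ threshold K j :=
  Nat.one_le_pow _ _ hK

/-! ### Both branches preserve the invariant -/

section

variable {K d n m w j : ℕ} {S L : List Clause} {a : ℕ → ℕ} {H : Clause}

theorem IsFirstHeart.exists_clause (hH : IsFirstHeart K d n S H w j) :
    ∃ C ∈ S, C.length = w ∧ H ⊆ C := by
  have h : 0 < (family S H w).length := lt_of_le_of_lt (Nat.zero_le _) hH.threshold_lt
  obtain ⟨C, hC⟩ := List.exists_mem_of_length_pos h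
  rw [family, List.mem_filter, decide_eq_true_eq] at hC
  exact ⟨C, hC⟩

/-- `H` is a proper subset of some clause of the antichain `S`, so no clause of `S` lies inside it.
Since `H` is shorter than `w`, the clauses of its length are light already. -/
theorem SparsifyInv.insert_heart (h : SparsifyInv K d n m S L a) (hK : 1 ≤ K)
    (hH : IsFirstHeart K d n S H w j) :
    SparsifyInv K d n m (QBFLower.insertClauses [H] S) (pushClauses [H] L)
      (Function.update a (w - j) (a (w - j) + 1)) := by
  obtain ⟨C, hC, hCw, hHC⟩ := hH.exists_clause
  have hCn := h.antichain.within C hC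
  have h1 := hH.one_le
  have h2 := hH.lt
  have h3 := hH.le
  have h4 := hH.length_eq
  refine h.insertClauses (r := w - j) (P := [H]) (by omega) (by omega) ?_ ?_ ?_ ?_ ?_
  · rw [List.forall_mem_singleton]
    exact ⟨⟨hH.nodup, by omega, fun l hl => hCn.2.2 l (hHC hl)⟩, h4⟩
  · simp
  · rw [List.forall_mem_singleton]
    intro D hD hDH
    obtain rfl := h.antichain.eq_of_subset hD hC (List.Subset.trans hDH hHC)
    have := (List.subperm_of_subset hCn.1 hDH).length_le
    omega
  · exact fun G hG1 hG2 hG3 => hH.light_of_lt _ G (by omega) hG1 hG2 hG3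
  · intro G _ _ _
    rw [degree_cons, degree_nil]
    have := threshold_pos hK (w - j - G.length)
    split <;> omega

theorem length_petals (S : List Clause) (H : Clause) (w : ℕ) :
    (petals S H w).length = degree S w H := by
  simp [petals, degree]

/-- Petals inherit incomparability from their clauses, as these share `H`. A clause of `S` inside a
petal would be a proper part of another clause, because `H` is nonempty. -/
theorem SparsifyInv.insert_petals (h : SparsifyInv K d n m S L a)
    (hH : IsFirstHeart K d n S H w j) :
    SparsifyInv K d n m (QBFLower.insertClauses (petals S H w) S)
      (pushClauses (petals S H w) L) (Function.update a j (a j + (petals S H w).length)) := by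
  have h1 := hH.one_le
  have h2 := hH.lt
  have h3 := hH.le
  have h4 := hH.length_eq
  have hpet : ∀ Y ∈ petals S H w, ∃ C ∈ S, C.length = w ∧ H ⊆ C ∧
      Y = C.filter fun l => l ∉ H := by
    intro Y hY
    simp only [petals, family, List.mem_map, List.mem_filter, decide_eq_true_eq] at hY
    obtain ⟨C, ⟨hC, hCw, hHC⟩, rfl⟩ := hY
    exact ⟨C, hC, hCw, hHC, rfl⟩
  refine h.insertClauses h1 (by omega) ?_ ?_ ?_ ?_ ?_
  · intro Y hY
    obtain ⟨C, hC, hCw, hHC, rfl⟩ := hpet Y hY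
    have hCn := h.antichain.within C hC
    have hlen := length_filter_notMem hH.nodup hCn.1 hHC
    refine ⟨⟨hCn.1.filter _, by omega, fun l hl => hCn.2.2 l (List.mem_filter.1 hl).1⟩,
      by omega⟩
  · unfold petals
    rw [List.pairwise_map]
    have aux : ∀ C D : Clause, H ⊆ D →
        (C.filter fun l => l ∉ H) ⊆ (D.filter fun l => l ∉ H) → C ⊆ D := by
      intro C D hD hs l hl
      by_cases hlH : l ∈ H
      · exact hD hlH
      · exact (List.mem_filter.1 (hs (List.mem_filter.2 ⟨hl, by simpa using hlH⟩))).1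
    refine (h.antichain.pairwise.filter _).imp_of_mem fun {C D} hC hD hCD => ?_
    simp only [family, List.mem_filter, decide_eq_true_eq] at hC hD
    exact ⟨fun hs => hCD.1 (aux C D hD.2.2 hs), fun hs => hCD.2 (aux D C hC.2.2 hs)⟩
  · intro Y hY D hD hDY
    obtain ⟨C, hC, hCw, hHC, rfl⟩ := hpet Y hY
    obtain rfl := h.antichain.eq_of_subset hD hC fun l hl => (List.mem_filter.1 (hDY hl)).1
    obtain ⟨l, hl⟩ := List.exists_mem_of_length_pos (by omega : 0 < H.length)
    have := (List.mem_filter.1 (hDY (hHC hl))).2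
    simp [hl] at this
  · exact fun G hG1 hG2 hG3 => hH.light_of_lt _ G (by omega) hG1 hG2 hG3
  · intro G hG1 hG2 hG3
    -- The petals containing `G` come from clauses of length `w` containing `H ++ G`, a larger heart
    -- and therefore a light one. If `G` meets `H`, no petal contains it.
    by_cases hdis : List.Disjoint H G
    · have hnd : (H ++ G).Nodup := List.Nodup.append hH.nodup hG1 hdis
      have hlen : (H ++ G).length = w - j + G.length := by rw [List.length_append, h4]
      have hlight := hH.light (H ++ G) hnd (by omega) (by omega)
      rw [show w - (H ++ G).length = j - G.length by omega] at hlight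
      refine le_trans ?_ hlight
      unfold degree petals family
      rw [← List.countP_eq_length_filter, List.countP_map, List.countP_filter,
        ← List.countP_eq_length_filter]
      refine List.countP_mono_left fun C hC => ?_
      simp only [Function.comp, Bool.and_eq_true, decide_eq_true_eq]
      rintro ⟨⟨-, hG⟩, hCw, hHC⟩
      refine ⟨hCw, List.append_subset.2 ⟨hHC, fun l hl => (List.mem_filter.1 (hG hl)).1⟩⟩
    · rw [degree_eq_zero]
      · exact Nat.zero_le _
      · intro Y hY _ hGY
        obtain ⟨C, hC, hCw, hHC, rfl⟩ := hpet Y hY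
        refine hdis fun l hlH hlG => ?_
        have := (List.mem_filter.1 (hGY hlG)).2
        simp [hlH] at this

end

/-! ### The number of branches -/

/-- The potential of a state in which `a s` clauses of length `s` have been added. -/
noncomputable def potential (K d : ℕ) (a : ℕ → ℕ) : ℝ :=
  ∑ s ∈ Finset.Ico 1 d, (a s : ℝ) / threshold K s

theorem potential_update {K d r : ℕ} (hr : 1 ≤ r) (hrd : r < d) (a : ℕ → ℕ) (p : ℕ) :
    potential K d (Function.update a r (a r + p)) =
      potential K d a + (p : ℝ) / threshold K r := by
  have hmem : r ∈ Finset.Ico 1 d := Finset.mem_Ico.2 ⟨hr, hrd⟩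
  unfold potential
  rw [← Finset.add_sum_erase _ _ hmem, ← Finset.add_sum_erase _ _ hmem,
    Function.update_self, Finset.sum_congr rfl fun i hi => by
      rw [Function.update_of_ne (Finset.ne_of_mem_erase hi)]]
  push_cast
  ring

theorem sum_update {d r : ℕ} (hr : 1 ≤ r) (hrd : r < d) (a : ℕ → ℕ) (p : ℕ) :
    ∑ s ∈ Finset.Ico 1 d, Function.update a r (a r + p) s =
      ∑ s ∈ Finset.Ico 1 d, a s + p := by
  have hmem : r ∈ Finset.Ico 1 d := Finset.mem_Ico.2 ⟨hr, hrd⟩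
  rw [← Finset.add_sum_erase _ _ hmem, ← Finset.add_sum_erase _ _ hmem,
    Function.update_self, Finset.sum_congr rfl fun i hi => by
      rw [Function.update_of_ne (Finset.ne_of_mem_erase hi)]]
  ring

/-- Each length contributes at most `n / K`, because the bound `n * K ^ (3 * s - 2)` on the added
clauses falls short of `n * threshold K s` by one factor `K`. -/
theorem SparsifyInv.potential_le {K d n m : ℕ} {S L : List Clause} {a : ℕ → ℕ}
    (h : SparsifyInv K d n m S L a) (hK : 2 * d + 4 ≤ K) :
    potential K d a ≤ d * n / K := by
  have hK0 : (0 : ℝ) < K := by exact_mod_cast (by omega : 0 < K)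
  have h1 : ∀ s ∈ Finset.Ico 1 d, (a s : ℝ) / threshold K s ≤ n / K := by
    intro s hs
    rw [Finset.mem_Ico] at hs
    have h2 : (a s : ℝ) ≤ n * (K : ℝ) ^ (3 * s - 2) := by
      exact_mod_cast h.added_le_pow hK s hs.1 hs.2.le
    have h3 : ((threshold K s : ℕ) : ℝ) = (K : ℝ) ^ (3 * s - 2) * K := by
      rw [threshold, ← pow_succ, show 3 * s - 2 + 1 = 3 * s - 1 by omega]
      push_cast; rfl
    rw [h3, div_le_div_iff₀ (by positivity) hK0]
    calc (a s : ℝ) * K ≤ n * (K : ℝ) ^ (3 * s - 2) * K := by gcongr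
      _ = n * ((K : ℝ) ^ (3 * s - 2) * K) := by ring
  refine (Finset.sum_le_sum h1).trans ?_
  rw [Finset.sum_const, Nat.card_Ico, nsmul_eq_mul, mul_div_assoc]
  have : ((d - 1 : ℕ) : ℝ) ≤ d := by exact_mod_cast Nat.sub_le d 1
  gcongr

theorem SparsifyInv.sum_le {K d n m : ℕ} {S L : List Clause} {a : ℕ → ℕ}
    (h : SparsifyInv K d n m S L a) (hK : 2 * d + 4 ≤ K) :
    ∑ s ∈ Finset.Ico 1 d, a s ≤ d * (n * K ^ (3 * d)) := by
  have h1 : ∀ s ∈ Finset.Ico 1 d, a s ≤ n * K ^ (3 * d) := by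
    intro s hs
    rw [Finset.mem_Ico] at hs
    exact (h.added_le_pow hK s hs.1 hs.2.le).trans
      (Nat.mul_le_mul_left _ (Nat.pow_le_pow_right (by omega) (by omega)))
  refine (Finset.sum_le_sum h1).trans ?_
  rw [Finset.sum_const, Nat.card_Ico, smul_eq_mul]
  exact Nat.mul_le_mul_right _ (Nat.sub_le d 1)

/-- The tree of the recursive calls of the sparsification algorithm on `S` has `N` nodes, and all
of them have the property `V`. -/
inductive SearchTree (K d n : ℕ) (V : List Clause → Prop) : List Clause → ℕ → Prop
  | leaf {S : List Clause} : V S → branch K d n S = [] → SearchTree K d n V S 1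
  | node {S S₁ S₂ : List Clause} {N₁ N₂ : ℕ} : V S → branch K d n S = [S₁, S₂] →
      (∀ a, MatrixHolds a S ↔ MatrixHolds a S₁ ∨ MatrixHolds a S₂) →
      SearchTree K d n V S₁ N₁ → SearchTree K d n V S₂ N₂ →
      SearchTree K d n V S (N₁ + N₂ + 1)

/-- The first summand is the heart branch, where the potential grows by `1 / t`; Bernoulli's
inequality for exponents in `[0, 1]` gives `(1 / 2) ^ (1 / t) ≤ 1 - 1 / (2 * t)`. The second is the
petal branch, where the growth is at least `1` and `2 ^ (-Λ)` is at most `1 / (2 * t)`. -/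
theorem two_rpow_add_two_rpow_le_one {Λ t u : ℕ} {p v : ℝ} (ht : 1 ≤ t) (htu : t ≤ u)
    (hΛ : 2 * u ≤ 2 ^ Λ) (hv : 0 < v) (hp : v ≤ p) :
    (2 : ℝ) ^ (-(Λ * (1 / (t : ℝ)))) + (2 : ℝ) ^ (-(Λ * (p / v))) ≤ 1 := by
  have hΛ1 : 1 ≤ Λ := by
    rcases Nat.eq_zero_or_pos Λ with rfl | h
    · simp at hΛ; omega
    · exact h
  have ht0 : (0 : ℝ) < t := by exact_mod_cast ht
  have ht1 : (1 : ℝ) ≤ t := by exact_mod_cast ht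
  have hΛr : (1 : ℝ) ≤ Λ := by exact_mod_cast hΛ1
  have h1 : (2 : ℝ) ^ (-(Λ * (1 / (t : ℝ)))) ≤ 1 - 1 / (2 * t) := by
    calc (2 : ℝ) ^ (-(Λ * (1 / (t : ℝ)))) ≤ (2 : ℝ) ^ (-(1 / (t : ℝ))) := by
          apply Real.rpow_le_rpow_of_exponent_le (by norm_num)
          have : 0 < 1 / (t : ℝ) := by positivity
          nlinarith
      _ = (1 + (-1 / 2)) ^ (1 / (t : ℝ)) := by
          rw [Real.rpow_neg (by norm_num), ← Real.inv_rpow (by norm_num)]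
          norm_num
      _ ≤ 1 + 1 / (t : ℝ) * (-1 / 2) := by
          apply rpow_one_add_le_one_add_mul_self (by norm_num) (by positivity)
          rw [div_le_one ht0]; exact ht1
      _ = 1 - 1 / (2 * t) := by field_simp; ring
  have h2 : (2 : ℝ) ^ (-(Λ * (p / v))) ≤ 1 / (2 * t) := by
    calc (2 : ℝ) ^ (-(Λ * (p / v))) ≤ (2 : ℝ) ^ (-(Λ : ℝ)) := by
          apply Real.rpow_le_rpow_of_exponent_le (by norm_num)
          have : 1 ≤ p / v := by rwa [le_div_iff₀ hv, one_mul]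
          nlinarith
      _ = 1 / (2 : ℝ) ^ Λ := by
          rw [Real.rpow_neg (by norm_num), Real.rpow_natCast, one_div]
      _ ≤ 1 / (2 * t) := by
          apply one_div_le_one_div_of_le (by positivity)
          have : 2 * t ≤ 2 ^ Λ := by omega
          exact_mod_cast this
  linarith

/-- The number of nodes is controlled by the potential still available. Termination has a separate
reason: every branching adds a clause, and the total number of added clauses is bounded by
`SparsifyInv.sum_le`. -/
theorem SparsifyInv.exists_searchTree {K d n m Λ : ℕ} (hK : 2 * d + 4 ≤ K)
    (hΛ : 2 * threshold K d ≤ 2 ^ Λ) {S L : List Clause} {a : ℕ → ℕ}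
    (h : SparsifyInv K d n m S L a) :
    ∃ N : ℕ, SearchTree K d n
      (fun S => Antichain n d S ∧ S.length ≤ m + d * (n * K ^ (3 * d))) S N ∧
      (N : ℝ) ≤ 2 * 2 ^ (Λ * (d * n / K - potential K d a)) - 1 := by
  induction hk : d * (n * K ^ (3 * d)) - ∑ s ∈ Finset.Ico 1 d, a s using
    Nat.strong_induction_on generalizing S L a with
  | _ k ih =>
    have hV : Antichain n d S ∧ S.length ≤ m + d * (n * K ^ (3 * d)) :=
      ⟨h.antichain, h.length_le.trans (Nat.add_le_add_left (h.sum_le hK) _)⟩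
    by_cases hb : branch K d n S = []
    · refine ⟨1, SearchTree.leaf hV hb, ?_⟩
      have : (1 : ℝ) ≤ 2 ^ (Λ * (d * n / K - potential K d a)) := by
        apply Real.one_le_rpow (by norm_num)
        have := h.potential_le hK
        exact mul_nonneg (Nat.cast_nonneg _) (by linarith)
      push_cast
      linarith
    · obtain ⟨H, w, j, hH, hb⟩ := exists_isFirstHeart h.antichain hb
      have h1 := hH.one_le
      have h2 := hH.lt
      have h3 := hH.le
      have hp := hH.threshold_lt
      rw [← length_petals] at hp
      have i1 := h.insert_heart (by omega) hH
      have i2 := h.insert_petals hH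
      -- Applied to the children, the bound shows that there was still room before the branching, so
      -- the truncated difference in the induction really decreases.
      have s1 := i1.sum_le hK
      have s2 := i2.sum_le hK
      rw [sum_update (by omega) (by omega)] at s1 s2
      obtain ⟨N₁, t1, b1⟩ := ih _ (by
        rw [sum_update (by omega) (by omega)]; omega) i1 rfl
      obtain ⟨N₂, t2, b2⟩ := ih _ (by
        rw [sum_update (by omega) (by omega)]; omega) i2 rfl
      refine ⟨N₁ + N₂ + 1, SearchTree.node hV hb
        (fun a => matrixHolds_iff_heart_or_petals a S H w) t1 t2, ?_⟩
      rw [potential_update (by omega) (by omega)] at b1 b2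
      have hKd : threshold K (w - j) ≤ threshold K d :=
        Nat.pow_le_pow_right (by omega) (by omega)
      have hpos : (0 : ℝ) < threshold K j := by
        exact_mod_cast threshold_pos (by omega) j
      have key := two_rpow_add_two_rpow_le_one (p := ((petals S H w).length : ℝ))
        (threshold_pos (by omega) (w - j)) hKd hΛ hpos (by exact_mod_cast hp.le)
      have hF : (0 : ℝ) < 2 ^ (Λ * (d * n / K - potential K d a)) := by positivity
      have e : ∀ x : ℝ, (2 : ℝ) ^ (Λ * (d * n / K - (potential K d a + x))) =
          2 ^ (Λ * (d * n / K - potential K d a)) * 2 ^ (-(Λ * x)) := by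
        intro x
        rw [← Real.rpow_add (by norm_num)]
        congr 1
        ring
      rw [e] at b1 b2
      -- The two bounds of the form `2 * _ - 1` and the node itself add up to `2 * _ - 1` again; the
      -- `-1` pays for the inner nodes.
      push_cast at b1 ⊢
      nlinarith

/-- When no heart is left, the number of clauses is linear in the number of variables. -/
theorem length_le_of_branch_eq_nil {K d n : ℕ} {S : List Clause} (hK : 1 ≤ K)
    (hS : Antichain n d S) (h : branch K d n S = []) :
    S.length ≤ d * (2 * threshold K d) * n + 1 := by
  have hsum : ∀ (T : List Clause), (∀ C ∈ T, C.length ≤ d) →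
      T.length = ∑ s ∈ Finset.range (d + 1), degree T s [] := by
    intro T
    induction T with
    | nil => simp [degree_nil]
    | cons C T ih =>
      intro hT
      rw [List.forall_mem_cons] at hT
      simp only [degree_cons, List.nil_subset, and_true]
      rw [Finset.sum_add_distrib, ← ih hT.2, List.length_cons, Finset.sum_ite_eq,
        if_pos (Finset.mem_range.2 (by omega)), add_comm]
  -- The length `0` is split off: only the empty clause has it, which accounts for the `+ 1`.
  rw [hsum S fun C hC => (hS.within C hC).2.1, Finset.sum_range_succ']
  refine Nat.add_le_add ?_ (degree_le_one hS.pairwise List.nodup_nil rfl)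
  have : ∀ s ∈ Finset.range d, degree S (s + 1) [] ≤ 2 * n * threshold K d := by
    intro s hs
    rw [Finset.mem_range] at hs
    refine degree_nil_le (by omega) (fun C hC => (hS.within C hC).2.2) fun l => ?_
    refine (degree_le_of_branch_eq_nil hS h (by omega) (List.nodup_singleton l) (by simp)
      (by simp)).trans ?_
    exact Nat.pow_le_pow_right hK (by simp; omega)
  refine (Finset.sum_le_sum this).trans ?_
  rw [Finset.sum_const, Finset.card_range, smul_eq_mul]
  exact le_of_eq (by ring)

/-! ### Quantifier blocks -/

theorem trueFrom_replicate_ex (cs : List Clause) (k : ℕ) : ∀ (i : ℕ) (a : ℕ → Bool),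
    TrueFrom i (List.replicate k Quant.ex) cs a ↔
      ∃ b : ℕ → Bool, (∀ j, j < i ∨ i + k ≤ j → b j = a j) ∧ MatrixHolds b cs := by
  induction k with
  | zero =>
    intro i a
    simp only [List.replicate_zero, TrueFrom, add_zero]
    constructor
    · exact fun h => ⟨a, fun _ _ => rfl, h⟩
    · rintro ⟨b, hb, h⟩
      rwa [show b = a from funext fun j => hb j (Nat.lt_or_ge j i)] at h
  | succ k ih =>
    intro i a
    have key : TrueFrom i (List.replicate (k + 1) Quant.ex) cs a ↔
        ∃ v : Bool, TrueFrom (i + 1) (List.replicate k Quant.ex) cs (Function.update a i v) := by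
      rw [List.replicate_succ, Bool.exists_bool]; rfl
    rw [key]
    simp only [ih]
    constructor
    · rintro ⟨v, b, hb, h⟩
      refine ⟨b, fun j hj => ?_, h⟩
      rw [hb j (by omega), Function.update_of_ne (by omega)]
    · rintro ⟨b, hb, h⟩
      refine ⟨b i, b, fun j hj => ?_, h⟩
      by_cases hji : j = i
      · rw [hji, Function.update_self]
      · rw [Function.update_of_ne hji, hb j (by omega)]

theorem trueFrom_replicate_all (cs : List Clause) (Q : List Quant) (l : ℕ) :
    ∀ (i : ℕ) (a : ℕ → Bool), TrueFrom i (List.replicate l Quant.all ++ Q) cs a ↔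
      ∀ b : ℕ → Bool, (∀ j, j < i ∨ i + l ≤ j → b j = a j) → TrueFrom (i + l) Q cs b := by
  induction l with
  | zero =>
    intro i a
    simp only [List.replicate_zero, List.nil_append, add_zero]
    constructor
    · intro h b hb
      rwa [show b = a from funext fun j => hb j (Nat.lt_or_ge j i)]
    · exact fun h => h a fun _ _ => rfl
  | succ l ih =>
    intro i a
    have key : TrueFrom i (List.replicate (l + 1) Quant.all ++ Q) cs a ↔
        ∀ v : Bool, TrueFrom (i + 1) (List.replicate l Quant.all ++ Q) cs
          (Function.update a i v) := by
      rw [List.replicate_succ, Bool.forall_bool]; rfl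
    rw [key]
    simp only [ih]
    rw [show i + (l + 1) = i + 1 + l by ring]
    constructor
    · intro h b hb
      refine h (b i) b fun j hj => ?_
      by_cases hji : j = i
      · rw [hji, Function.update_self]
      · rw [Function.update_of_ne hji, hb j (by omega)]
    · intro h v b hb
      refine h b fun j hj => ?_
      rw [hb j (by omega), Function.update_of_ne (by omega)]

theorem isTrue_forallExists_iff (l k : ℕ) (cs : List Clause) :
    QCNF.IsTrue ⟨List.replicate l Quant.all ++ List.replicate k Quant.ex, cs⟩ ↔
      ∀ a : ℕ → Bool, (∀ j, l ≤ j → a j = false) →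
        ∃ b : ℕ → Bool, (∀ j, j < l ∨ l + k ≤ j → b j = a j) ∧ MatrixHolds b cs := by
  simp only [QCNF.IsTrue, trueFrom_replicate_all, trueFrom_replicate_ex, zero_add, not_lt_zero,
    false_or]

/-! ### Selecting one of `s` objects -/

/-- The variable `x_{o+2i+1}` stands for the selection of the `i`-th object, and the variables
`x_{o+2i}` are auxiliary; the clauses say that at least one object is selected. -/
def chain (o s : ℕ) : List Clause :=
  [(o, true)] :: [(o + 2 * s, false)] :: (List.range s).map fun i =>
    [(o + 2 * i, false), (o + 2 * i + 2, true), (o + 2 * i + 1, true)]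

/-- If nothing is selected, the clauses become implications that carry truth from `x_o` to
`x_{o+2s}`, whose negation is also a clause. -/
theorem exists_selected_of_chain {b : ℕ → Bool} {o s : ℕ} (h : MatrixHolds b (chain o s)) :
    ∃ i < s, b (o + 2 * i + 1) = true := by
  by_contra hcon
  push Not at hcon
  simp only [MatrixHolds, chain, List.forall_mem_cons, List.mem_map, List.mem_range,
    List.exists_mem_cons_iff, Literal.Holds, List.not_mem_nil, false_and, exists_false,
    or_false] at h
  obtain ⟨h0, h1, h2⟩ := h
  have key : ∀ i ≤ s, b (o + 2 * i) = true := by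
    intro i
    induction i with
    | zero => intro _; exact h0
    | succ i ih =>
      intro hi
      have h3 := h2 _ ⟨i, by omega, rfl⟩
      simp only [List.exists_mem_cons_iff, List.not_mem_nil, false_and, exists_false,
        or_false] at h3
      rcases h3 with h3 | h3 | h3
      · rw [ih (by omega)] at h3; cases h3
      · exact h3
      · exact absurd h3 (hcon i (by omega))
  rw [key s le_rfl] at h1
  cases h1

/-- The values of the variables of `chain o s` when the object number `a` is selected. -/
def selection (a m : ℕ) : Bool := if m % 2 = 0 then m / 2 ≤ a else m / 2 = a

theorem selection_two_mul (a i : ℕ) : selection a (2 * i) = decide (i ≤ a) := by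
  simp [selection]

theorem selection_two_mul_add_one (a i : ℕ) :
    selection a (2 * i + 1) = decide (i = a) := by
  have h1 : (2 * i + 1) % 2 = 1 := by omega
  have h2 : (2 * i + 1) / 2 = i := by omega
  simp [selection, h1, h2]

theorem matrixHolds_chain {b : ℕ → Bool} {o s a : ℕ} (ha : a < s)
    (h : ∀ m ≤ 2 * s, b (o + m) = selection a m) : MatrixHolds b (chain o s) := by
  have h2 : ∀ i ≤ s, b (o + 2 * i) = decide (i ≤ a) := fun i hi => by
    rw [h _ (by omega), selection_two_mul]
  have h3 : ∀ i < s, b (o + 2 * i + 1) = decide (i = a) := fun i hi => by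
    rw [add_assoc, h _ (by omega), selection_two_mul_add_one]
  intro C hC
  simp only [chain, List.mem_cons, List.mem_map, List.mem_range] at hC
  rcases hC with rfl | rfl | ⟨i, hi, rfl⟩
  · refine ⟨_, List.mem_cons_self, ?_⟩
    simpa [Literal.Holds] using h2 0 (by omega)
  · refine ⟨_, List.mem_cons_self, ?_⟩
    simp only [Literal.Holds]
    rw [h2 s le_rfl]
    simpa using ha
  · rcases lt_trichotomy i a with h | h | h
    · refine ⟨(o + 2 * i + 2, true), by simp, ?_⟩
      have := h2 (i + 1) (by omega)
      simp only [Literal.Holds]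
      rw [show o + 2 * i + 2 = o + 2 * (i + 1) by ring, this]
      simpa using h
    · refine ⟨(o + 2 * i + 1, true), by simp, ?_⟩
      simp only [Literal.Holds]
      rw [h3 i hi]
      simpa using h
    · refine ⟨(o + 2 * i, false), by simp, ?_⟩
      simp only [Literal.Holds]
      rw [h2 i hi.le]
      simpa using h

/-! ### Unsatisfiability as a quantified formula -/

/-- If the row `i` and the column `j` of an array with `r` columns are selected, then the array has
an entry `C` there, and `C` is false. -/
def cellClauses (S : List Clause) (r o₁ o₂ i j : ℕ) : List Clause :=
  match S.drop (i * r + j) with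
  | [] => [[(o₁ + 2 * i + 1, false), (o₂ + 2 * j + 1, false)]]
  | C :: _ => C.map fun l => [(o₁ + 2 * i + 1, false), (o₂ + 2 * j + 1, false), (l.1, !l.2)]

def falsityMatrix (n r s : ℕ) (S : List Clause) : List Clause :=
  (chain (n + 1) s ++ chain (n + 1 + (2 * s + 1)) r) ++
    (List.range s).flatMap fun i => (List.range r).flatMap fun j =>
      cellClauses S r (n + 1) (n + 1 + (2 * s + 1)) i j

/-- For every assignment of the first `n + 1` variables, some clause of `S` is false. The clauses
are arranged in an array with `s` rows and `r` columns. -/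
def falsityFormula (n r s : ℕ) (S : List Clause) : QCNF where
  quants := List.replicate (n + 1) Quant.all ++
    List.replicate (2 * s + 1 + (2 * r + 1)) Quant.ex
  matrix := falsityMatrix n r s S

theorem drop_eq_cons {α : Type} {S : List α} {k : ℕ} {C : α} {T : List α}
    (h : S.drop k = C :: T) : C ∈ S := by
  have : C ∈ S.drop k := by rw [h]; exact List.mem_cons_self
  exact List.mem_of_mem_drop this

/-- The chains may select several rows and columns, but every selected cell must then hold a false
clause, so one suffices. A cell beyond the end of `S` has a clause forbidding its selection. An
empty clause of `S` imposes no condition, rightly so, since it is always false. -/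
theorem isTrue_falsityFormula {n r s : ℕ} {S : List Clause}
    (hS : ∀ C ∈ S, ∀ l ∈ C, l.1 < n) (hrs : S.length ≤ s * r) :
    (falsityFormula n r s S).IsTrue ↔ ¬ ∃ a, MatrixHolds a S := by
  rw [falsityFormula, isTrue_forallExists_iff]
  constructor
  · rintro h ⟨x, hx⟩
    -- The universal assignments are `false` beyond their block, as in the initial assignment, so
    -- `x` is cut off there.
    obtain ⟨b, hb, hm⟩ := h (fun j => if j < n + 1 then x j else false)
      (fun j hj => if_neg (by omega))
    simp only [falsityMatrix, MatrixHolds, List.forall_mem_append] at hm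
    obtain ⟨⟨h1, h2⟩, h3⟩ := hm
    obtain ⟨i, hi, hbi⟩ := exists_selected_of_chain h1
    obtain ⟨j, hj, hbj⟩ := exists_selected_of_chain h2
    have h4 : MatrixHolds b
        (cellClauses S r (n + 1) (n + 1 + (2 * s + 1)) i j) := fun C hC =>
      h3 C (List.mem_flatMap.2 ⟨i, List.mem_range.2 hi,
        List.mem_flatMap.2 ⟨j, List.mem_range.2 hj, hC⟩⟩)
    unfold cellClauses at h4
    split at h4
    · simp only [MatrixHolds, List.forall_mem_singleton, Literal.Holds] at h4
      simp [hbi, hbj] at h4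
    · next C T hC =>
      have hCS := drop_eq_cons hC
      obtain ⟨l, hl, hxl⟩ := hx C hCS
      have h5 := h4 _ (List.mem_map_of_mem hl)
      have hln := hS C hCS l hl
      have hbl : b l.1 = x l.1 := by
        rw [hb l.1 (by omega)]
        exact if_pos (by omega)
      simp only [Literal.Holds] at hxl
      simp [Literal.Holds, hbi, hbj, hbl, hxl] at h5
  · intro h x hx
    have hfalse : ¬ MatrixHolds x S := fun hx => h ⟨x, hx⟩
    simp only [MatrixHolds] at hfalse
    push Not at hfalse
    obtain ⟨C, hC, hCx⟩ := hfalse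
    obtain ⟨k, hk, rfl⟩ := List.getElem_of_mem hC
    have hr : 0 < r := by
      rcases Nat.eq_zero_or_pos r with rfl | hr
      · omega
      · exact hr
    -- The `k`-th clause stands in row `k / r` and column `k % r`; `hrs` ensures that this row
    -- exists.
    have hi : k / r < s := Nat.div_lt_of_lt_mul (by rw [mul_comm]; omega)
    have hj : k % r < r := Nat.mod_lt _ hr
    let b : ℕ → Bool := fun j =>
      if j < n + 1 then x j
      else if j < n + 1 + (2 * s + 1) then selection (k / r) (j - (n + 1))
      else if j < n + 1 + (2 * s + 1) + (2 * r + 1) then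
        selection (k % r) (j - (n + 1 + (2 * s + 1)))
      else x j
    have hb1 : ∀ m ≤ 2 * s, b (n + 1 + m) = selection (k / r) m := by
      intro m hm
      simp only [b]
      rw [if_neg (by omega), if_pos (by omega), Nat.add_sub_cancel_left]
    have hb2 : ∀ m ≤ 2 * r, b (n + 1 + (2 * s + 1) + m) = selection (k % r) m := by
      intro m hm
      simp only [b]
      rw [if_neg (by omega), if_neg (by omega), if_pos (by omega), Nat.add_sub_cancel_left]
    refine ⟨b, fun j hj => ?_, ?_⟩
    · simp only [b]
      rcases hj with hj | hj
      · rw [if_pos hj]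
      · rw [if_neg (by omega), if_neg (by omega), if_neg (by omega)]
    · simp only [falsityMatrix, MatrixHolds, List.forall_mem_append]
      refine ⟨⟨matrixHolds_chain hi hb1, matrixHolds_chain hj hb2⟩, fun D hD => ?_⟩
      simp only [List.mem_flatMap, List.mem_range] at hD
      obtain ⟨i, his, j, hjr, hD⟩ := hD
      have hbi : b (n + 1 + 2 * i + 1) = decide (i = k / r) := by
        rw [add_assoc (n + 1), hb1 _ (by omega), selection_two_mul_add_one]
      have hbj : b (n + 1 + (2 * s + 1) + 2 * j + 1) = decide (j = k % r) := by
        rw [add_assoc (n + 1 + (2 * s + 1)), hb2 _ (by omega), selection_two_mul_add_one]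
      by_cases hik : i = k / r
      · by_cases hjk : j = k % r
        · have hidx : i * r + j = k := by
            rw [hik, hjk, mul_comm]; exact Nat.div_add_mod k r
          unfold cellClauses at hD
          rw [hidx, List.drop_eq_getElem_cons hk] at hD
          simp only [List.mem_map] at hD
          obtain ⟨l, hl, rfl⟩ := hD
          refine ⟨(l.1, !l.2), by simp, ?_⟩
          have hln := hS _ hC l hl
          have hne := hCx l hl
          simp only [Literal.Holds] at hne ⊢
          simp only [b]
          rw [if_pos (by omega)]
          cases h : x l.1 <;> cases h' : l.2 <;> simp_all
        · refine ⟨(n + 1 + (2 * s + 1) + 2 * j + 1, false), ?_, ?_⟩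
          · unfold cellClauses at hD
            split at hD
            · simp only [List.mem_singleton] at hD; simp [hD]
            · obtain ⟨l, -, rfl⟩ := List.mem_map.1 hD; simp
          · simp [Literal.Holds, hbj, hjk]
      · refine ⟨(n + 1 + 2 * i + 1, false), ?_, ?_⟩
        · unfold cellClauses at hD
          split at hD
          · simp only [List.mem_singleton] at hD; simp [hD]
          · obtain ⟨l, -, rfl⟩ := List.mem_map.1 hD; simp
        · simp [Literal.Holds, hbi, hik]

/-- The number of existential variables. -/
theorem numEx_falsityFormula (n r s : ℕ) (S : List Clause) :
    (falsityFormula n r s S).numEx = 2 * s + 2 * r + 2 := by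
  have h1 : List.count Quant.ex (List.replicate (n + 1) Quant.all) = 0 := by
    rw [List.count_replicate]; rfl
  rw [falsityFormula, QCNF.numEx, List.count_append, h1, List.count_replicate_self]
  ring

/-! ### Properties of the quantified formula -/

/-- The conditions on a single clause in `ProperMatrix`. -/
def ProperClause (n : ℕ) (C : Clause) : Prop :=
  C.Nodup ∧ (∀ l ∈ C, l.1 < n) ∧ ∀ i : ℕ, ¬ ((i, true) ∈ C ∧ (i, false) ∈ C)

/-- The clauses differ as sets of literals. -/
def Differ (C D : Clause) : Prop := ¬ ∀ l : Literal, l ∈ C ↔ l ∈ D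

theorem differ_of_mem {C D : Clause} {l : Literal} (hC : l ∈ C) (hD : l ∉ D) : Differ C D :=
  fun h => hD ((h l).1 hC)

theorem differ_of_mem' {C D : Clause} {l : Literal} (hC : l ∉ C) (hD : l ∈ D) : Differ C D :=
  fun h => hC ((h l).2 hD)

theorem mem_chain {o s : ℕ} {C : Clause} : C ∈ chain o s ↔
    C = [(o, true)] ∨ C = [(o + 2 * s, false)] ∨
      ∃ i < s, C = [(o + 2 * i, false), (o + 2 * i + 2, true), (o + 2 * i + 1, true)] := by
  simp only [chain, List.mem_cons, List.mem_map, List.mem_range, eq_comm]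

theorem properClause_of_mem_chain {o s N : ℕ} (hN : o + 2 * s < N) {C : Clause}
    (hC : C ∈ chain o s) : ProperClause N C := by
  rcases mem_chain.1 hC with rfl | rfl | ⟨i, hi, rfl⟩
  · exact ⟨by simp, by simp; omega, by simp⟩
  · exact ⟨by simp, by simp; omega, by simp⟩
  · refine ⟨by simp, ?_, fun j => ?_⟩
    · simp only [List.forall_mem_cons]
      exact ⟨by omega, by omega, by omega, by simp⟩
    · simp only [List.mem_cons, Prod.mk.injEq, List.not_mem_nil]
      simp
      omega

theorem exists_var_of_mem_chain {o s : ℕ} {C : Clause} (hC : C ∈ chain o s) :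
    (∃ l ∈ C, l.1 ≤ o + 2 * s) ∧ (∀ l ∈ C, o ≤ l.1) := by
  rcases mem_chain.1 hC with rfl | rfl | ⟨i, hi, rfl⟩
  · simp
  · simp
  · refine ⟨⟨_, List.mem_cons_self, by simp; omega⟩, ?_⟩
    simp only [List.forall_mem_cons]
    exact ⟨by omega, by omega, by omega, by simp⟩

/-- Selection variables occur only positively in a chain. Every cell clause contains them negated,
and so differs from all clauses of both chains. -/
theorem notMem_chain {o s k : ℕ} {C : Clause} (hC : C ∈ chain o s) :
    (o + 2 * k + 1, false) ∉ C := by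
  rcases mem_chain.1 hC with rfl | rfl | ⟨i, hi, rfl⟩ <;>
    simp only [List.mem_cons, Prod.mk.injEq, List.not_mem_nil] <;> simp <;> omega

theorem pairwise_chain (o s : ℕ) : (chain o s).Pairwise Differ := by
  unfold chain
  rw [List.pairwise_cons, List.pairwise_cons, List.pairwise_map]
  refine ⟨?_, ?_, ?_⟩
  · intro C hC
    refine differ_of_mem (l := (o, true)) (by simp) ?_
    simp only [List.mem_cons, List.mem_map] at hC
    rcases hC with rfl | ⟨i, -, rfl⟩
    · simp
    · simp
      omega
  · intro C hC
    obtain ⟨i, -, rfl⟩ := List.mem_map.1 hC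
    exact differ_of_mem' (l := (o + 2 * i + 1, true)) (by simp) (by simp)
  · refine List.pairwise_lt_range.imp fun {i j} h => ?_
    refine differ_of_mem (l := (o + 2 * i + 1, true)) (by simp) ?_
    simp
    omega

theorem mem_cellClauses {S : List Clause} {r o₁ o₂ i j : ℕ} {C : Clause}
    (hC : C ∈ cellClauses S r o₁ o₂ i j) :
    C = [(o₁ + 2 * i + 1, false), (o₂ + 2 * j + 1, false)] ∨
      ∃ D ∈ S, ∃ l ∈ D,
        C = [(o₁ + 2 * i + 1, false), (o₂ + 2 * j + 1, false), (l.1, !l.2)] := by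
  unfold cellClauses at hC
  split at hC
  · left; simpa using hC
  · next D T hD =>
    obtain ⟨l, hl, rfl⟩ := List.mem_map.1 hC
    exact Or.inr ⟨D, drop_eq_cons hD, l, hl, rfl⟩

section

variable {n d r s : ℕ} {S : List Clause}

theorem properClause_of_mem_cellClauses (hS : ∀ C ∈ S, ClauseWithin n d C) {o₁ o₂ i j N : ℕ}
    (hn : n ≤ o₁) (h₁ : o₁ + 2 * i + 1 < o₂) (h₂ : o₂ + 2 * j + 1 < N) {C : Clause}
    (hC : C ∈ cellClauses S r o₁ o₂ i j) : ProperClause N C := by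
  rcases mem_cellClauses hC with rfl | ⟨D, hD, l, hl, rfl⟩
  · refine ⟨?_, ?_, by simp⟩
    · simp; omega
    · simp only [List.forall_mem_cons]
      exact ⟨by omega, by omega, by simp⟩
  · have hln := (hS D hD).2.2 l hl
    refine ⟨?_, ?_, ?_⟩
    · simp; omega
    · simp only [List.forall_mem_cons]
      exact ⟨by omega, by omega, by omega, by simp⟩
    · intro k
      simp only [List.mem_cons, Prod.mk.injEq, List.not_mem_nil]
      rcases l with ⟨l, b⟩
      simp only at hln
      cases b
      · simp; omega
      · simp

theorem pairwise_cellClauses (hS : ∀ C ∈ S, ClauseWithin n d C) {o₁ o₂ i j : ℕ}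
    (hn : n ≤ o₁) (h₁ : o₁ ≤ o₂) : (cellClauses S r o₁ o₂ i j).Pairwise Differ := by
  unfold cellClauses
  split
  · simp
  · next C T hC =>
    have hCS := hS C (drop_eq_cons hC)
    rw [List.pairwise_map]
    refine List.Pairwise.imp_of_mem (fun {l l'} hl hl' hne => ?_) hCS.1
    have h1 := hCS.2.2 l hl
    refine differ_of_mem (l := (l.1, !l.2)) (by simp) ?_
    simp only [List.mem_cons, Prod.mk.injEq, List.not_mem_nil, or_false]
    rintro (h | h | h)
    · omega
    · omega
    · exact hne (Prod.ext h.1 (by simpa using h.2))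

theorem forall_mem_falsityMatrix {p : Clause → Prop}
    (h₁ : ∀ C ∈ chain (n + 1) s, p C) (h₂ : ∀ C ∈ chain (n + 1 + (2 * s + 1)) r, p C)
    (h₃ : ∀ i < s, ∀ j < r,
      ∀ C ∈ cellClauses S r (n + 1) (n + 1 + (2 * s + 1)) i j, p C) :
    ∀ C ∈ falsityMatrix n r s S, p C := by
  intro C hC
  simp only [falsityMatrix, List.mem_append, List.mem_flatMap, List.mem_range] at hC
  rcases hC with (hC | hC) | ⟨i, hi, j, hj, hC⟩
  · exact h₁ C hC
  · exact h₂ C hC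
  · exact h₃ i hi j hj C hC

theorem properMatrix_falsityMatrix (hS : ∀ C ∈ S, ClauseWithin n d C) :
    ProperMatrix (n + 1 + (2 * s + 1 + (2 * r + 1))) (falsityMatrix n r s S) := by
  have aux : ∀ {o₁ o₂ i j i' j' : ℕ} {C D : Clause}, n ≤ o₁ → o₁ + 2 * i + 1 < o₂ →
      o₁ + 2 * i' + 1 < o₂ → C ∈ cellClauses S r o₁ o₂ i j →
      D ∈ cellClauses S r o₁ o₂ i' j' → i ≠ i' ∨ j ≠ j' → Differ C D := by
    intro o₁ o₂ i j i' j' C D hn h h' hC hD hne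
    rcases hne with hne | hne
    · refine differ_of_mem (l := (o₁ + 2 * i + 1, false)) ?_ ?_
      · rcases mem_cellClauses hC with rfl | ⟨E, -, l, -, rfl⟩ <;> simp
      · rcases mem_cellClauses hD with rfl | ⟨E, hE, l, hl, rfl⟩
        · simp; omega
        · have := (hS E hE).2.2 l hl
          simp only [List.mem_cons, Prod.mk.injEq, List.not_mem_nil, and_true, or_false]
          rintro (h | h | ⟨h, -⟩) <;> omega
    · refine differ_of_mem (l := (o₂ + 2 * j + 1, false)) ?_ ?_
      · rcases mem_cellClauses hC with rfl | ⟨E, -, l, -, rfl⟩ <;> simp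
      · rcases mem_cellClauses hD with rfl | ⟨E, hE, l, hl, rfl⟩
        · simp; omega
        · have := (hS E hE).2.2 l hl
          simp only [List.mem_cons, Prod.mk.injEq, List.not_mem_nil, and_true, or_false]
          rintro (h | h | ⟨h, -⟩) <;> omega
  refine ⟨forall_mem_falsityMatrix (fun C hC => properClause_of_mem_chain (by omega) hC)
    (fun C hC => properClause_of_mem_chain (by omega) hC)
    fun i hi j hj C hC => properClause_of_mem_cellClauses hS (by omega) (by omega) (by omega) hC,
    ?_⟩
  change (falsityMatrix n r s S).Pairwise Differ
  unfold falsityMatrix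
  rw [List.pairwise_append, List.pairwise_append]
  refine ⟨⟨pairwise_chain _ _, pairwise_chain _ _, ?_⟩, ?_, ?_⟩
  · intro C hC D hD
    obtain ⟨⟨l, hl, hlo⟩, -⟩ := exists_var_of_mem_chain hC
    obtain ⟨-, h⟩ := exists_var_of_mem_chain hD
    exact differ_of_mem hl fun hlD => by have := h l hlD; omega
  · rw [List.pairwise_flatMap]
    constructor
    · intro i hi
      rw [List.mem_range] at hi
      rw [List.pairwise_flatMap]
      constructor
      · exact fun j _ => pairwise_cellClauses hS (by omega) (by omega)
      · exact List.pairwise_lt_range.imp fun {j j'} h C hC D hD =>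
          aux (by omega) (by omega) (by omega) hC hD (Or.inr h.ne)
    · refine List.pairwise_lt_range.imp_of_mem fun {i i'} hi hi' h C hC D hD => ?_
      rw [List.mem_range] at hi hi'
      obtain ⟨j, -, hC⟩ := List.mem_flatMap.1 hC
      obtain ⟨j', -, hD⟩ := List.mem_flatMap.1 hD
      exact aux (by omega) (by omega) (by omega) hC hD (Or.inl h.ne)
  · intro C hC D hD
    simp only [List.mem_flatMap, List.mem_range] at hD
    obtain ⟨i, hi, j, hj, hD⟩ := hD
    have h1 : (n + 1 + 2 * i + 1, false) ∈ D ∧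
        (n + 1 + (2 * s + 1) + 2 * j + 1, false) ∈ D := by
      rcases mem_cellClauses hD with rfl | ⟨E, -, l, -, rfl⟩ <;> simp
    rcases List.mem_append.1 hC with hC | hC
    · exact differ_of_mem' (notMem_chain hC) h1.1
    · exact differ_of_mem' (notMem_chain hC) h1.2

/-- The universal block has `n + 1` variables, one more than `S` needs, so that it is nonempty even
for `n = 0`. -/
theorem isForallExistsCNF_falsityFormula (hS : ∀ C ∈ S, ClauseWithin n d C) :
    (falsityFormula n r s S).IsForallExistsCNF 3 := by
  refine ⟨⟨n + 1, 2 * s + 1 + (2 * r + 1), by omega, rfl⟩, ?_, ?_⟩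
  · have := properMatrix_falsityMatrix (r := r) (s := s) hS
    simpa [falsityFormula] using this
  · have h : ∀ o k, ∀ C ∈ chain o k, C.length ≤ 3 := fun o k C hC => by
      rcases mem_chain.1 hC with rfl | rfl | ⟨i, -, rfl⟩ <;> simp
    exact forall_mem_falsityMatrix (h _ _) (h _ _) fun i _ j _ C hC => by
      rcases mem_cellClauses hC with rfl | ⟨E, -, l, -, rfl⟩ <;> simp

end

/-! ### Sizes -/

theorem matrixSize_le_sz (cs : List Clause) : matrixSize cs ≤ sz cs := by
  induction cs with
  | nil => simp [matrixSize]
  | cons C cs ih =>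
    have := length_lt_sz C
    simp only [matrixSize, List.map_cons, List.sum_cons, sz_cons] at *
    omega

theorem size_le_sz (Φ : QCNF) : Φ.size ≤ sz (Φ.quants, Φ.matrix) := by
  have := length_lt_sz Φ.quants
  have := matrixSize_le_sz Φ.matrix
  rw [sz_prod]
  simp only [QCNF.size]
  omega

theorem sz_clause_le {n : ℕ} {C : Clause} (hC : ∀ l ∈ C, l.1 < n) :
    sz C ≤ C.length * (2 * n + 4) + 1 := by
  refine sz_list_le C (2 * n + 3) fun l hl => ?_
  have := hC l hl
  have := sz_bool_le l.2
  rw [sz_literal, sz_nat]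
  omega

theorem sz_matrix_le {n d : ℕ} {S : List Clause} (hS : ∀ C ∈ S, ClauseWithin n d C) :
    sz S ≤ S.length * (d * (2 * n + 4) + 2) + 1 := by
  refine sz_list_le S _ fun C hC => ?_
  obtain ⟨-, h1, h2⟩ := hS C hC
  exact (sz_clause_le h2).trans (Nat.add_le_add_right (Nat.mul_le_mul_right _ h1) 1)

theorem length_le_matrixSize (cs : List Clause) : cs.length ≤ matrixSize cs := by
  induction cs with
  | nil => simp [matrixSize]
  | cons C cs ih =>
    simp only [matrixSize, List.map_cons, List.sum_cons, List.length_cons] at *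
    omega

/-! ### The reduction takes polynomial time -/

section

variable {α : Type} [Enc α]

theorem Poly.chain {f g : α → ℕ} (hf : Poly f) (hg : Poly g) :
    Poly (fun a => chain (f a) (g a)) := by
  have h2 : Poly fun a => f a + 2 * g a := hf.add ((Poly.const 2).mul hg)
  have h3 : Poly fun x : α × ℕ => f x.1 + 2 * x.2 :=
    (hf.comp Poly.fst).add ((Poly.const 2).mul Poly.snd)
  exact Poly.cons ((hf.literal (Poly.const true)).cons Poly.nil)
    (Poly.cons ((h2.literal (Poly.const false)).cons Poly.nil)
      (hg.range.map (g := fun x : α × ℕ =>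
        [((f x.1 + 2 * x.2, false) : Literal), (f x.1 + 2 * x.2 + 2, true),
          (f x.1 + 2 * x.2 + 1, true)])
        ((h3.literal (Poly.const false)).cons
          (((h3.add (Poly.const 2)).literal (Poly.const true)).cons
            (((h3.add (Poly.const 1)).literal (Poly.const true)).cons Poly.nil)))))

theorem Poly.cellClauses (r : ℕ) {S : α → List Clause} {o₁ o₂ i j : α → ℕ} (hS : Poly S)
    (h₁ : Poly o₁) (h₂ : Poly o₂) (hi : Poly i) (hj : Poly j) :
    Poly (fun a => cellClauses (S a) r (o₁ a) (o₂ a) (i a) (j a)) := by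
  have l1 : Poly fun a => ((o₁ a + 2 * i a + 1, false) : Literal) :=
    ((h₁.add ((Poly.const 2).mul hi)).add (Poly.const 1)).literal (Poly.const false)
  have l2 : Poly fun a => ((o₂ a + 2 * j a + 1, false) : Literal) :=
    ((h₂.add ((Poly.const 2).mul hj)).add (Poly.const 1)).literal (Poly.const false)
  refine Poly.listCases (((hi.mul (Poly.const r)).add hj).drop hS)
    (f := fun a => [[(o₁ a + 2 * i a + 1, false), (o₂ a + 2 * j a + 1, false)]])
    (g := fun x : α × Clause × List Clause => x.2.1.map fun l =>
      [(o₁ x.1 + 2 * i x.1 + 1, false), (o₂ x.1 + 2 * j x.1 + 1, false), (l.1, !l.2)])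
    ((l1.cons (l2.cons Poly.nil)).cons Poly.nil) ?_ ?_ ?_
  · have hx := Poly.fst' (Poly.fst (α := α × Clause × List Clause) (β := Literal))
    have hl := Poly.snd (α := α × Clause × List Clause) (β := Literal)
    exact (Poly.fst' Poly.snd).map (g := fun y : (α × Clause × List Clause) × Literal =>
      [((o₁ y.1.1 + 2 * i y.1.1 + 1, false) : Literal),
        (o₂ y.1.1 + 2 * j y.1.1 + 1, false), (y.2.1, !y.2.2)])
      ((l1.comp hx).cons ((l2.comp hx).cons
        ((hl.literalVar.literal hl.literalSign.not).cons Poly.nil)))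
  · intro a h
    simp only [QBFLower.cellClauses, h]
  · intro a b bs h
    simp only [QBFLower.cellClauses, h]

theorem Poly.falsityMatrix (r : ℕ) {S : α → List Clause} {n s : α → ℕ} (hS : Poly S)
    (hn : Poly n) (hs : Poly s) : Poly (fun a => falsityMatrix (n a) r (s a) (S a)) := by
  have h1 : Poly fun a => n a + 1 := hn.add (Poly.const 1)
  have h2 : Poly fun a => n a + 1 + (2 * s a + 1) :=
    h1.add (((Poly.const 2).mul hs).add (Poly.const 1))
  refine ((h1.chain hs).append (h2.chain (Poly.const r))).append ?_
  refine hs.range.flatMap (g := fun x : α × ℕ => (List.range r).flatMap fun j =>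
    QBFLower.cellClauses (S x.1) r (n x.1 + 1) (n x.1 + 1 + (2 * s x.1 + 1)) x.2 j) ?_
  have hx := Poly.fst' (Poly.fst (α := α × ℕ) (β := ℕ))
  exact (Poly.const (List.range r)).flatMap (g := fun y : (α × ℕ) × ℕ =>
    QBFLower.cellClauses (S y.1.1) r (n y.1.1 + 1) (n y.1.1 + 1 + (2 * s y.1.1 + 1)) y.1.2 y.2)
    (Poly.cellClauses r (hS.comp hx) (h1.comp hx) (h2.comp hx) (Poly.snd' Poly.fst) Poly.snd)

theorem Poly.replicate {β : Type} [Enc β] {n : α → ℕ} (hn : Poly n) (b : β) :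
    Poly (fun a => List.replicate (n a) b) :=
  (hn.range.map (g := fun _ => b) (Poly.const b)).congr fun a => by
    rw [List.map_const', List.length_range]

theorem Poly.falsityFormula (r : ℕ) {S : α → List Clause} {n s : α → ℕ} (hS : Poly S)
    (hn : Poly n) (hs : Poly s) :
    Poly (fun a => ((falsityFormula (n a) r (s a) (S a)).quants,
      (falsityFormula (n a) r (s a) (S a)).matrix)) :=
  (((hn.add (Poly.const 1)).replicate Quant.all).append
    (((((Poly.const 2).mul hs).add (Poly.const 1)).add (Poly.const (2 * r + 1))).replicate
      Quant.ex)).pair (Poly.falsityMatrix r hS hn hs)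

/-- One more than the number of multiples of `R` between `1` and `n`. -/
def numRows (R n : ℕ) : ℕ := ((List.range n).filter fun i => R * (i + 1) < n + 1).length + 1

theorem Poly.numRows (R : ℕ) {n : α → ℕ} (hn : Poly n) : Poly (fun a => numRows R (n a)) := by
  refine Poly.add (Poly.length (hn.range.filter (g := fun x : α × ℕ =>
    decide (R * (x.2 + 1) < n x.1 + 1)) ?_)) (Poly.const 1)
  exact ((Poly.const R).mul (Poly.snd.add (Poly.const 1))).lt
    ((hn.comp Poly.fst).add (Poly.const 1))

end

/-- Division by a constant is obtained by counting multiples, which needs only multiplication,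
comparison and filtering in unary. -/
theorem numRows_eq {R : ℕ} (hR : 1 ≤ R) (n : ℕ) : numRows R n = n / R + 1 := by
  have key : ∀ m k : ℕ, ((List.range m).filter fun i => i < k).length = min m k := by
    intro m k
    induction m with
    | zero => simp
    | succ m ih =>
      rw [List.range_succ, List.filter_append, List.length_append, ih]
      by_cases h : m < k
      · simp [h]; omega
      · simp [h]; omega
  rw [numRows]
  have : (fun i => decide (R * (i + 1) < n + 1)) = fun i => decide (i < n / R) := by
    funext i
    rw [decide_eq_decide, Nat.lt_succ_iff, mul_comm, ← Nat.le_div_iff_mul_le (by omega)]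
    omega
  rw [this, key, min_eq_right (Nat.div_le_self n R)]

/-! ### The search program -/

/-- The final state of the search when a satisfiable formula has been found. -/
def acceptTree : BTree :=
  BTree.node (BTree.node (BTree.node BTree.nil BTree.nil) BTree.nil) BTree.nil

def acceptProg : Prog :=
  Prog.pair (Prog.pair (Prog.pair Prog.nil Prog.nil) Prog.nil) Prog.nil

/-- From a state `(n, S :: W)`, the input `(n, S)` for the processing of `S`. -/
def headProg : Prog := Prog.pair Prog.left (Prog.comp Prog.right Prog.left)

/-- The first formula of a list of formulas is replaced by its branches, as computed by `pB`, or
removed if it is found unsatisfiable by `pQ`. -/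
def searchBody (pB pQ : Prog) : Prog :=
  Prog.cond (Prog.comp headProg pB)
    (Prog.pair Prog.left (Prog.pair (Prog.comp (Prog.comp headProg pB) Prog.left)
      (Prog.pair (Prog.comp (Prog.comp (Prog.comp headProg pB) Prog.right) Prog.left)
        (Prog.comp Prog.right Prog.right))))
    (Prog.cond (Prog.comp headProg pQ)
      (Prog.pair Prog.left (Prog.comp Prog.right Prog.right)) acceptProg)

def searchLoop (pB pQ : Prog) : Prog := Prog.loop Prog.right (searchBody pB pQ)

def searchProg (pR pB pQ : Prog) : Prog :=
  Prog.comp (Prog.pair Prog.left (Prog.pair pR Prog.nil))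
    (Prog.comp (searchLoop pB pQ) (Prog.comp Prog.left Prog.left))

/-- The list is the stack of a depth-first search. A satisfiable formula on top ends the loop with
acceptance whatever lies below; an unsatisfiable one is removed, at a cost proportional to its tree,
and the loop goes on as it would from `W`. -/
theorem searchLoop_runs {K d n T : ℕ} {V : List Clause → Prop} {pB pQ : Prog}
    (hB : ∀ S, V S → ∃ t, Runs pB (enc (n, S)) (enc (branch K d n S)) t ∧ t ≤ T)
    (hQ : ∀ S, V S → branch K d n S = [] → ∃ y t, Runs pQ (enc (n, S)) y t ∧ t ≤ T ∧
      (y ≠ BTree.nil ↔ ¬ ∃ a, MatrixHolds a S))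
    {S : List Clause} {N : ℕ} (h : SearchTree K d n V S N) : ∀ W : List (List Clause),
    ((∃ a, MatrixHolds a S) → ∃ t, Runs (searchLoop pB pQ) (enc (n, S :: W)) acceptTree t ∧
      t ≤ N * (3 * T + 50)) ∧
    ((¬ ∃ a, MatrixHolds a S) → ∀ z t₀, Runs (searchLoop pB pQ) (enc (n, W)) z t₀ →
      ∃ t, Runs (searchLoop pB pQ) (enc (n, S :: W)) z t ∧ t ≤ N * (3 * T + 50) + t₀) := by
  have hhead : ∀ (S : List Clause) (W : List (List Clause)),
      Runs headProg (enc (n, S :: W)) (enc (n, S)) 5 := fun S W =>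
    Runs.pair (Runs.left _) (Runs.comp (Runs.right _) (Runs.left _))
  induction h with
  | @leaf S hV hb =>
    intro W
    obtain ⟨t, ht, hT⟩ := hB S hV
    obtain ⟨y, t', ht', hT', hy⟩ := hQ S hV hb
    rw [hb] at ht
    constructor
    · intro hsat
      have hy0 : y = BTree.nil := by
        by_contra hne
        exact hy.1 hne hsat
      subst hy0
      refine ⟨_, Runs.loopStep (Runs.right _) (Runs.condFalse (Runs.comp (hhead S W) ht)
        (Runs.condFalse (Runs.comp (hhead S W) ht')
          (Runs.pair (Runs.pair (Runs.pair (Runs.nil _) (Runs.nil _)) (Runs.nil _))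
            (Runs.nil _)))) (Runs.loopDone (Runs.right _)), ?_⟩
      omega
    · intro hunsat z t₀ hz
      have hy0 := hy.2 hunsat
      cases y with
      | nil => exact absurd rfl hy0
      | node u v =>
        refine ⟨_, Runs.loopStep (Runs.right _) (Runs.condFalse (Runs.comp (hhead S W) ht)
          (Runs.condTrue (Runs.comp (hhead S W) ht')
            (Runs.pair (Runs.left _) (Runs.comp (Runs.right _) (Runs.right _))))) hz, ?_⟩
        omega
  | @node S S₁ S₂ N₁ N₂ hV hb heq _ _ ih₁ ih₂ =>
    intro W
    obtain ⟨t, ht, hT⟩ := hB S hV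
    rw [hb] at ht
    have step : ∀ z t₀, Runs (searchLoop pB pQ) (enc (n, S₁ :: S₂ :: W)) z t₀ →
        ∃ t', Runs (searchLoop pB pQ) (enc (n, S :: W)) z t' ∧ t' ≤ 3 * T + 50 + t₀ := by
      intro z t₀ hz
      have hc := Runs.comp (hhead S W) ht
      refine ⟨_, Runs.loopStep (Runs.right _) (Runs.condTrue hc
        (Runs.pair (Runs.left _) (Runs.pair (Runs.comp hc (Runs.left _))
          (Runs.pair (Runs.comp (Runs.comp hc (Runs.right _)) (Runs.left _))
            (Runs.comp (Runs.right _) (Runs.right _)))))) hz, ?_⟩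
      omega
    have e : (N₁ + N₂ + 1) * (3 * T + 50) =
        N₁ * (3 * T + 50) + N₂ * (3 * T + 50) + (3 * T + 50) := by ring
    rw [e]
    constructor
    · intro hsat
      by_cases h₁ : ∃ a, MatrixHolds a S₁
      · obtain ⟨t₁, r₁, b₁⟩ := (ih₁ (S₂ :: W)).1 h₁
        obtain ⟨t', r', b'⟩ := step _ _ r₁
        exact ⟨t', r', by omega⟩
      · have h₂ : ∃ a, MatrixHolds a S₂ := by
          obtain ⟨a, ha⟩ := hsat
          rcases (heq a).1 ha with h | h
          · exact absurd ⟨a, h⟩ h₁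
          · exact ⟨a, h⟩
        obtain ⟨t₂, r₂, b₂⟩ := (ih₂ W).1 h₂
        obtain ⟨t₁, r₁, b₁⟩ := (ih₁ (S₂ :: W)).2 h₁ _ _ r₂
        obtain ⟨t', r', b'⟩ := step _ _ r₁
        exact ⟨t', r', by omega⟩
    · intro hunsat z t₀ hz
      have h₁ : ¬ ∃ a, MatrixHolds a S₁ := fun ⟨a, ha⟩ => hunsat ⟨a, (heq a).2 (Or.inl ha)⟩
      have h₂ : ¬ ∃ a, MatrixHolds a S₂ := fun ⟨a, ha⟩ => hunsat ⟨a, (heq a).2 (Or.inr ha)⟩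
      obtain ⟨t₂, r₂, b₂⟩ := (ih₂ W).2 h₂ _ _ hz
      obtain ⟨t₁, r₁, b₁⟩ := (ih₁ (S₂ :: W)).2 h₁ _ _ r₂
      obtain ⟨t', r', b'⟩ := step _ _ r₁
      exact ⟨t', r', by omega⟩

theorem searchProg_runs {K d n T : ℕ} {V : List Clause → Prop} {pR pB pQ : Prog}
    (hB : ∀ S, V S → ∃ t, Runs pB (enc (n, S)) (enc (branch K d n S)) t ∧ t ≤ T)
    (hQ : ∀ S, V S → branch K d n S = [] → ∃ y t, Runs pQ (enc (n, S)) y t ∧ t ≤ T ∧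
      (y ≠ BTree.nil ↔ ¬ ∃ a, MatrixHolds a S))
    {S₀ S : List Clause} (hR : ∃ t, Runs pR (enc (n, S₀)) (enc S) t ∧ t ≤ T)
    {N : ℕ} (h : SearchTree K d n V S N) :
    ∃ y t, Runs (searchProg pR pB pQ) (enc (n, S₀)) y t ∧ t ≤ N * (3 * T + 50) + T + 50 ∧
      (y ≠ BTree.nil ↔ ∃ a, MatrixHolds a S) := by
  obtain ⟨t, ht, hT⟩ := hR
  have start : Runs (Prog.pair Prog.left (Prog.pair pR Prog.nil)) (enc (n, S₀)) (enc (n, [S]))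
      (1 + (t + 1 + 1) + 1) :=
    Runs.pair (Runs.left _) (Runs.pair ht (Runs.nil _))
  by_cases hsat : ∃ a, MatrixHolds a S
  · obtain ⟨t', r', b'⟩ := (searchLoop_runs hB hQ h []).1 hsat
    refine ⟨_, _, Runs.comp start (Runs.comp r' (Runs.comp (Runs.left _) (Runs.left _))),
      by omega, ?_⟩
    simp [acceptTree, BTree.left, hsat]
  · obtain ⟨t', r', b'⟩ := (searchLoop_runs hB hQ h []).2 hsat _ _
      (Runs.loopDone (Runs.right _))
    refine ⟨_, _, Runs.comp start (Runs.comp r' (Runs.comp (Runs.left _) (Runs.left _))),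
      by omega, ?_⟩
    -- An exhausted search ends in the state `(n, [])`. The left subtree of a unary number is always
    -- empty, in contrast to that position in `acceptTree`.
    have : (encNat n).left = BTree.nil := by cases n <;> rfl
    simp only [hsat, iff_false, not_not]
    exact this

/-! ### The choice of the parameters -/

/-- `Λ` need only exceed the binary logarithm of `threshold K d`, which is linear in `log K` for
fixed `d`, so a large power of two works as `K`. The last condition gives `Λ * d * n / K ≤ n / 4`.
-/
theorem exists_sparsify_parameters (d : ℕ) : ∃ K Λ : ℕ, 2 * d + 4 ≤ K ∧
    2 * threshold K d ≤ 2 ^ Λ ∧ 4 * (Λ * d) ≤ K := by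
  obtain ⟨A, hA⟩ : ∃ A, A = 12 * (d * d) + 4 * d + 4 := ⟨_, rfl⟩
  have h2 : ∀ B : ℕ, B + 1 ≤ 2 ^ B := fun B => Nat.lt_two_pow_self
  have h3 : 3 * (A * A) ≤ 2 ^ (3 * A) := by
    have h := Nat.pow_le_pow_left (h2 A) 3
    rw [← pow_mul, mul_comm A 3] at h
    nlinarith
  refine ⟨2 ^ (3 * A), 3 * A * (3 * d) + 1, ?_, ?_, ?_⟩
  · have := h2 (3 * A)
    omega
  · rw [threshold, ← pow_mul, ← pow_succ']
    refine Nat.pow_le_pow_right (by norm_num) ?_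
    exact Nat.add_le_add_right (Nat.mul_le_mul_left _ (by omega)) 1
  · refine le_trans ?_ h3
    have hA1 : 1 ≤ A := by omega
    calc 4 * ((3 * A * (3 * d) + 1) * d) = 3 * (A * (12 * (d * d))) + 4 * d := by ring
      _ ≤ 3 * (A * (12 * (d * d))) + 3 * (A * (4 * d)) := by nlinarith [Nat.zero_le d]
      _ ≤ 3 * (A * A) := by
        rw [← Nat.mul_add, ← Nat.mul_add]
        gcongr
        omega

/-- The base is replaced by a natural number `C₀` above `|c|` and `1`, since `c` may be negative.
With `R = C₀ ^ 2`, the crude bound `R ≤ 2 ^ R` turns the power `R ^ (n / (4 * R))` into at most `2 ^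
(n / 4)`. -/
theorem exists_base_le_two_pow (c : ℝ) : ∃ R C₀ : ℕ, 1 ≤ R ∧ ∀ e n : ℕ,
    c ^ (2 * (n / (4 * R)) + e) ≤ (C₀ : ℝ) ^ e * 2 ^ ((n : ℝ) / 4) := by
  obtain ⟨C₀, hC₀⟩ := exists_nat_ge (max |c| 1)
  have h1 : |c| ≤ C₀ := (le_max_left _ _).trans hC₀
  have h2 : (1 : ℝ) ≤ C₀ := (le_max_right _ _).trans hC₀
  refine ⟨C₀ ^ 2, C₀, ?_, fun e n => ?_⟩
  · have : 1 ≤ C₀ := by exact_mod_cast h2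
    exact Nat.one_le_pow _ _ this
  · have h3 : (((C₀ : ℝ)) ^ 2) ≤ 2 ^ (C₀ ^ 2) := by
      exact_mod_cast (Nat.lt_two_pow_self (n := C₀ ^ 2)).le
    have h4 : ((C₀ ^ 2 * (n / (4 * C₀ ^ 2)) : ℕ) : ℝ) ≤ (n : ℝ) / 4 := by
      rw [le_div_iff₀ (by norm_num)]
      have : C₀ ^ 2 * (n / (4 * C₀ ^ 2)) * 4 ≤ n := by
        have := Nat.mul_div_le n (4 * C₀ ^ 2)
        linarith
      exact_mod_cast this
    calc c ^ (2 * (n / (4 * C₀ ^ 2)) + e) ≤ |c| ^ (2 * (n / (4 * C₀ ^ 2)) + e) := by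
          rw [← abs_pow]; exact le_abs_self _
      _ ≤ (C₀ : ℝ) ^ (2 * (n / (4 * C₀ ^ 2)) + e) := by gcongr
      _ = (C₀ : ℝ) ^ e * (((C₀ : ℝ)) ^ 2) ^ (n / (4 * C₀ ^ 2)) := by
          rw [pow_add, pow_mul, mul_comm]
      _ ≤ (C₀ : ℝ) ^ e * (2 ^ (C₀ ^ 2)) ^ (n / (4 * C₀ ^ 2)) := by gcongr
      _ = (C₀ : ℝ) ^ e * 2 ^ ((C₀ ^ 2 * (n / (4 * C₀ ^ 2)) : ℕ) : ℝ) := by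
          rw [Real.rpow_natCast, ← pow_mul]
      _ ≤ (C₀ : ℝ) ^ e * 2 ^ ((n : ℝ) / 4) := by
          gcongr
          norm_num

/-- Satisfiability of formulas in `d`-CNF is decided in time `2 ^ (n / 2)`, up to a factor
polynomial in the size, if `∀∃3-CNF` formulas with `k` existential variables can be decided in time
`c ^ k`, up to such a factor. -/
theorem ForallExistsSolvable.satSolvable {c : ℝ} (h : ForallExistsSolvable 3 c) (d : ℕ) :
    SatSolvable d (1 / 2) := by
  obtain ⟨pO, qO, hO⟩ := h
  obtain ⟨K, Λ, hK, hΛ, hΛK⟩ := exists_sparsify_parameters d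
  obtain ⟨R, C₀, hR, hc⟩ := exists_base_le_two_pow c
  -- Sparse formulas have at most `B * n + 1` clauses. With `n / (4 * R) + 1` rows, `4 * R * (B +
  -- 1)` columns provide enough cells, and their number does not depend on `n`.
  obtain ⟨B, hB⟩ : ∃ B, B = d * (2 * threshold K d) := ⟨_, rfl⟩
  obtain ⟨r, hr⟩ : ∃ r, r = 4 * R * (B + 1) := ⟨_, rfl⟩
  obtain ⟨pE, qE, hE⟩ := Poly.falsityFormula r (Poly.snd (α := ℕ) (β := List Clause)) Poly.fst
    (Poly.numRows (4 * R) Poly.fst)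
  obtain ⟨pB, qB, hpB⟩ := Poly.branch K d
  obtain ⟨pR, qR, hpR⟩ := Poly.insertClauses (Poly.snd (α := ℕ) (β := List Clause)) Poly.nil
  -- `P₁` bounds the presentation of the input clauses, `P₂` that of every formula in the search
  -- tree, which has at most `d * n * K ^ (3 * d)` clauses more than the initial antichain. `Z`
  -- covers both together with `n`.
  let P₁ : ℕ[X] := X * ((d : ℕ[X]) * (2 * X + 4) + 2) + 1
  let P₂ : ℕ[X] := (P₁ + 1 + (d : ℕ[X]) * (X * ((K ^ (3 * d) : ℕ) : ℕ[X]))) *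
    ((d : ℕ[X]) * (2 * X + 4) + 2) + 1
  let Z : ℕ[X] := 2 * X + 2 + P₁ + P₂
  let W : ℕ[X] := qB.comp Z + qR.comp Z + qE.comp Z + 1 +
    ((C₀ ^ (2 * r + 4) : ℕ) : ℕ[X]) * qO.comp (qE.comp Z)
  refine ⟨searchProg pR pB (Prog.comp pE pO), 2 * (3 * W + 50), fun φ hφ => ?_⟩
  obtain ⟨⟨hφ1, -⟩, hφ2⟩ := hφ
  have hwithin : ∀ C ∈ φ.clauses, ClauseWithin φ.numVars d C := fun C hC =>
    ⟨(hφ1 C hC).1, hφ2 C hC, (hφ1 C hC).2.1⟩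
  obtain ⟨n, hn⟩ : ∃ n, n = φ.numVars := ⟨_, rfl⟩
  obtain ⟨x, hx⟩ : ∃ x, x = φ.size := ⟨_, rfl⟩
  rw [← hn] at hwithin
  have hnx : n ≤ x := by rw [hn, hx, CNF.size]; omega
  have hlx : φ.clauses.length ≤ x := by
    have := length_le_matrixSize φ.clauses
    rw [hx, CNF.size]; omega
  -- Only the minimal clauses are kept: the invariant requires an antichain, and satisfiability does
  -- not change.
  let S₀ := insertClauses φ.clauses []
  have hS₀ : Antichain n d S₀ :=
    Antichain.insertClauses ⟨by simp, List.Pairwise.nil⟩ hwithin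
  have hszφ : sz φ.clauses ≤ P₁.eval x := by
    refine (sz_matrix_le hwithin).trans ?_
    simp only [P₁, eval_add, eval_mul, eval_X, eval_natCast, Nat.cast_id, eval_ofNat,
        eval_one]
    gcongr
  have hm : S₀.length ≤ P₁.eval x + 1 := by
    have h1 : sz S₀ ≤ _ := sz_insertClauses_le φ.clauses []
    have h2 := length_lt_sz S₀
    simp only [sz_nil] at h1
    omega
  obtain ⟨N, hN, hNle⟩ := (SparsifyInv.initial (K := K) hS₀).exists_searchTree hK hΛ
  have hVsz : ∀ S, (Antichain n d S ∧ S.length ≤ S₀.length + d * (n * K ^ (3 * d))) →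
      sz (n, S) ≤ Z.eval x := by
    rintro S ⟨hS, hlen⟩
    have h1 := sz_matrix_le hS.within
    have h2 : S.length * (d * (2 * n + 4) + 2) + 1 ≤ P₂.eval x := by
      simp only [P₂, eval_add, eval_mul, eval_X, eval_natCast, Nat.cast_id, eval_ofNat,
        eval_one]
      gcongr
      exact hlen.trans (by gcongr)
    rw [sz_prod, sz_nat]
    simp only [Z, eval_add, eval_mul, eval_X, eval_ofNat]
    omega
  have hφZ : sz (n, φ.clauses) ≤ Z.eval x := by
    rw [sz_prod, sz_nat]
    simp only [Z, eval_add, eval_mul, eval_X, eval_ofNat]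
    omega
  obtain ⟨G, hG⟩ : ∃ G : ℝ, G = 2 ^ ((n : ℝ) / 4) := ⟨_, rfl⟩
  have hG1 : 1 ≤ G := by
    rw [hG]; exact Real.one_le_rpow (by norm_num) (by positivity)
  obtain ⟨O, hOdef⟩ : ∃ O : ℝ,
      O = (C₀ : ℝ) ^ (2 * r + 4) * G * (qO.eval (qE.eval (Z.eval x)) : ℕ) := ⟨_, rfl⟩
  have hO0 : 0 ≤ O := by rw [hOdef]; positivity
  -- A common bound for the subprograms. `O` bounds the time of the assumed algorithm for quantified
  -- formulas; being real, it is rounded down, which is harmless for a natural number of steps.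
  obtain ⟨T, hT⟩ : ∃ T, T = qB.eval (Z.eval x) + qR.eval (Z.eval x) + qE.eval (Z.eval x) + 1 +
    ⌊O⌋₊ := ⟨_, rfl⟩
  have hQ : ∀ S, (Antichain n d S ∧ S.length ≤ S₀.length + d * (n * K ^ (3 * d))) →
      branch K d n S = [] → ∃ y t, Runs (Prog.comp pE pO) (enc (n, S)) y t ∧ t ≤ T ∧
      (y ≠ BTree.nil ↔ ¬ ∃ a, MatrixHolds a S) := by
    intro S hV hb
    have hS := hV.1
    have hrows := numRows_eq (show 1 ≤ 4 * R by omega) n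
    have hlen : S.length ≤ numRows (4 * R) n * r := by
      have h1 := length_le_of_branch_eq_nil (by omega) hS hb
      rw [← hB] at h1
      have h2 : n < 4 * R * (n / (4 * R) + 1) := Nat.lt_mul_div_succ n (by omega)
      rw [hrows, hr]
      calc S.length ≤ B * n + 1 := h1
        _ ≤ (n + 1) * (B + 1) := by nlinarith
        _ ≤ 4 * R * (n / (4 * R) + 1) * (B + 1) := Nat.mul_le_mul_right _ h2
        _ = (n / (4 * R) + 1) * (4 * R * (B + 1)) := by ring
    obtain ⟨t₁, r₁, b₁, c₁⟩ := hE (n, S)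
    obtain ⟨y, t₂, r₂, b₂, hy⟩ := hO (falsityFormula n r (numRows (4 * R) n) S)
      (isForallExistsCNF_falsityFormula hS.within)
    refine ⟨y, _, Runs.comp r₁ r₂, ?_,
      hy.trans (isTrue_falsityFormula (fun C hC => (hS.within C hC).2.2) hlen)⟩
    have hZE := eval_mono qE (hVsz S hV)
    have hO' : (t₂ : ℝ) ≤ O := by
      refine b₂.trans ?_
      beta_reduce
      have e : (falsityFormula n r (numRows (4 * R) n) S).numEx =
          2 * (n / (4 * R)) + (2 * r + 4) := by
        rw [numEx_falsityFormula, hrows]; ring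
      rw [e, hOdef, hG]
      have hsz : (falsityFormula n r (numRows (4 * R) n) S).size ≤ qE.eval (Z.eval x) :=
        (size_le_sz _).trans (c₁.trans hZE)
      have hmono : ((qO.eval (falsityFormula n r (numRows (4 * R) n) S).size : ℕ) : ℝ) ≤
          (qO.eval (qE.eval (Z.eval x)) : ℕ) := by
        exact_mod_cast eval_mono qO hsz
      exact mul_le_mul (hc (2 * r + 4) n) hmono (Nat.cast_nonneg _) (by positivity)
    have hfl : t₂ ≤ ⌊O⌋₊ := Nat.le_floor hO'
    omega
  have hB' : ∀ S, (Antichain n d S ∧ S.length ≤ S₀.length + d * (n * K ^ (3 * d))) →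
      ∃ t, Runs pB (enc (n, S)) (enc (branch K d n S)) t ∧ t ≤ T := by
    intro S hV
    obtain ⟨t, r₁, b₁, -⟩ := hpB (n, S)
    have := eval_mono qB (hVsz S hV)
    exact ⟨t, r₁, by omega⟩
  have hR' : ∃ t, Runs pR (enc (n, φ.clauses)) (enc S₀) t ∧ t ≤ T := by
    obtain ⟨t, r₁, b₁, -⟩ := hpR (n, φ.clauses)
    have := eval_mono qR hφZ
    exact ⟨t, r₁, by omega⟩
  obtain ⟨y, t, hrun, ht, hy⟩ := searchProg_runs hB' hQ hR' hN
  have henc : φ.enc = enc (n, φ.clauses) := by rw [hn]; rfl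
  refine ⟨y, t, by rw [henc]; exact hrun, ?_, hy.trans ?_⟩
  · have hT' : (T : ℝ) ≤ G * (W.eval x : ℕ) := by
      have hfl : (⌊O⌋₊ : ℝ) ≤ O := Nat.floor_le hO0
      have h0 : (0 : ℝ) ≤ (qB.eval (Z.eval x) + qR.eval (Z.eval x) + qE.eval (Z.eval x) + 1 : ℕ) :=
        Nat.cast_nonneg _
      rw [hT, Nat.cast_add]
      simp only [W, eval_add, eval_mul, eval_comp, eval_natCast, Nat.cast_id, eval_one]
      rw [Nat.cast_add (qB.eval (Z.eval x) + qR.eval (Z.eval x) + qE.eval (Z.eval x) + 1)]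
      have hO2 : O = G * ((C₀ ^ (2 * r + 4) * qO.eval (qE.eval (Z.eval x)) : ℕ) : ℝ) := by
        rw [hOdef]; push_cast; ring
      nlinarith
    have hN' : (N : ℝ) ≤ 2 * G - 1 := by
      refine hNle.trans ?_
      rw [hG]
      have hpot : potential K d (fun _ => 0) = 0 := by simp [potential]
      rw [hpot, sub_zero]
      have hK0 : (0 : ℝ) < K := by exact_mod_cast (by omega : 0 < K)
      have hexp : (Λ : ℝ) * (d * n / K) ≤ (n : ℝ) / 4 := by
        rw [← mul_div_assoc, div_le_div_iff₀ hK0 (by norm_num)]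
        have h4 : 4 * ((Λ : ℝ) * d) ≤ K := by exact_mod_cast hΛK
        nlinarith [(Nat.cast_nonneg n : (0 : ℝ) ≤ n)]
      have := Real.rpow_le_rpow_of_exponent_le (by norm_num : (1 : ℝ) ≤ 2) hexp
      linarith
    have hG2 : (2 : ℝ) ^ (1 / 2 * (φ.numVars : ℝ)) = G * G := by
      rw [hG, ← hn, ← Real.rpow_add (by norm_num)]
      congr 1; ring
    beta_reduce
    rw [hG2, ← hx]
    have ht' : (t : ℝ) ≤ N * (3 * T + 50) + T + 50 := by exact_mod_cast ht
    have hW : (0 : ℝ) ≤ (W.eval x : ℕ) := Nat.cast_nonneg _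
    have hT0 : (0 : ℝ) ≤ T := Nat.cast_nonneg _
    have h3 : 3 * (T : ℝ) + 50 ≤ G * (3 * (W.eval x : ℕ) + 50) := by nlinarith
    have e : ((eval x (2 * (3 * W + 50)) : ℕ) : ℝ) = 2 * (3 * (W.eval x : ℕ) + 50) := by
      simp only [eval_add, eval_mul, eval_ofNat]
      push_cast; ring
    rw [e]
    -- One factor `G = 2 ^ (n / 4)` comes from the number of nodes, since `N + 1 ≤ 2 * G`, and the
    -- other from the cost of a node.
    calc (t : ℝ) ≤ (N + 1) * (3 * T + 50) := by nlinarith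
      _ ≤ (2 * G) * (G * (3 * (W.eval x : ℕ) + 50)) :=
        mul_le_mul (by linarith) h3 (by positivity) (by positivity)
      _ = G * G * (2 * (3 * (W.eval x : ℕ) + 50)) := by ring
  · have : ∀ a, MatrixHolds a S₀ ↔ MatrixHolds a φ.clauses := fun a => by
      rw [matrixHolds_insertClauses]
      simp [MatrixHolds]
    simp only [CNF.Satisfiable, this]

/-! ### The contradiction with SETH -/

theorem satExponent_le {d : ℕ} {c : ℝ} (h : SatSolvable d c) (hc : 0 ≤ c) :
    satExponent d ≤ c := by
  by_cases hb : BddBelow {c : ℝ | SatSolvable d c}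
  · exact csInf_le hb h
  -- The infimum of a set of reals unbounded below is `0` by convention, so `0 ≤ c` settles this
  -- case and it need not be ruled out.
  · rw [satExponent, Real.sInf_of_not_bddBelow hb]
    exact hc

end QBFLower

theorem mainTheorem3 (hSETH : QBFLower.SETH) (c : ℝ) :
    ¬ QBFLower.ForallExistsSolvable 3 c := by
  intro h
  have h1 : (1 : ℝ) ≤ 1 / 2 := le_of_tendsto' hSETH fun d =>
    QBFLower.satExponent_le (h.satSolvable d) (by norm_num)
  norm_num at h1
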